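/- Let $k$ be a field, $Q$ a quiver with countably many vertices, and $kQ$ its path category: the objects are the vertices of $Q$, and $kQ(x,y)$ is the $k$-vector space with basis the paths from $x$ to $y$. Let $I$ be an ideal of $kQ$ that is contained in the ideal generated by all paths of length two and such that $kQ(x,y)/I(x,y)$ is finite dimensional for all vertices $x,y$; the pair $(Q,I)$ is called a bound quiver. Put $A=kQ/I$. Let $\mathrm{rep}(Q,I)$ be the (abelian) category of locally finite dimensional representations of $(Q,I)$, that is, of $k$-linear functors $M$ from $A$ to $k$-vector spaces with $M(x)$ finite dimensional for every vertex $x$. For a vertex $x$ let $P_x=A(x,-)$ and $I_x=\mathrm{Hom}_k(A(-,x),k)$, which are objects of $\mathrm{rep}(Q,I)$. An object $M$ of $\mathrm{rep}(Q,I)$ is finitely generated if there is an epimorphism $P\to M$ with $P$ a finite direct sum of representations of the form $P_x$, and finitely presented if there is such an epimorphism whose kernel is finitely generated. Dually, $M$ is finitely co-generated if there is a monomorphism $M\to J$ with $J$ a finite direct sum of representations of the form $I_x$, and finitely co-presented if there is such a monomorphism whose cokernel is finitely co-generated. In an abelian category, a morphism $g:E\to N$ is right almost split if it is not a retraction and every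 morphism $X\to N$ that is not a retraction factors through $g$; a morphism $f:L\to E$ is left almost split if it is not a section and every morphism $L\to X$ that is not a section factors through $f$. An almost split sequence is a non-split short exact sequence $0\to L\xrightarrow{f}E\xrightarrow{g}N\to 0$ with $L$ and $N$ indecomposable, $f$ left almost split and $g$ right almost split; it starts in $L$ and ends in $N$. **Theorem.** Let $M\in\mathrm{rep}(Q,I)$ be indecomposable. 1. There is an almost split sequence in $\mathrm{rep}(Q,I)$ ending in $M$ if and only if $M$ is finitely presented and not projective in $\mathrm{rep}(Q,I)$. 2. There is an almost split sequence in $\mathrm{rep}(Q,I)$ starting in $M$ if and only if $M$ is finitely co-presented and not injective in $\mathrm{rep}(Q,I)$. -/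

import Mathlib

open CategoryTheory CategoryTheory.Limits

universe u v w t

/-! ### Ideals of linear categories and their quotient categories -/

/-- A (two-sided) ideal of a `k`-linear category `C`: a subspace of every space of morphisms,
stable under composition with arbitrary morphisms on both sides. -/
structure LinearIdeal (k : Type u) [Field k] (C : Type v) [Category.{w} C]
    [Preadditive C] [Linear k C] where
  /-- the subspace of the space of morphisms `x ⟶ y` -/
  carrier : ∀ x y : C, Submodule k (x ⟶ y)
  comp_mem : ∀ {x y z : C} (f : x ⟶ y) {g : y ⟶ z}, g ∈ carrier y z → f ≫ g ∈ carrier x z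
  mem_comp : ∀ {x y z : C} {f : x ⟶ y} (g : y ⟶ z), f ∈ carrier x y → f ≫ g ∈ carrier x z

namespace LinearIdeal

variable {k : Type u} [Field k] {C : Type v} [Category.{w} C] [Preadditive C] [Linear k C]

/-- The ideal generated by a family of sets of morphisms. -/
def span (S : ∀ x y : C, Set (x ⟶ y)) : LinearIdeal k C where
  carrier x y := ⨅ (J : LinearIdeal k C) (_ : ∀ a b, S a b ⊆ J.carrier a b), J.carrier x y
  comp_mem f _ hg := by
    simp only [Submodule.mem_iInf] at hg ⊢
    exact fun J hJ => J.comp_mem f (hg J hJ)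
  mem_comp g hf := by
    simp only [Submodule.mem_iInf] at hf ⊢
    exact fun J hJ => J.mem_comp g (hf J hJ)

/-- Two parallel morphisms are identified when their difference lies in the ideal. -/
def homRel (I : LinearIdeal k C) : HomRel C :=
  fun x y f g => f - g ∈ I.carrier x y

instance (I : LinearIdeal k C) : Congruence I.homRel where
  comp_left f g g' h := by
    have := I.comp_mem f h
    rwa [Preadditive.comp_sub] at this
  comp_right g h := by
    have := I.mem_comp g h
    rwa [Preadditive.sub_comp] at this
  equivalence :=
    { refl := fun f => by simp [homRel]
      symm := fun {f g} h => by
        have := Submodule.neg_mem _ h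
        rwa [neg_sub] at this
      trans := fun {f g l} h h' => by
        have := Submodule.add_mem _ h h'
        rwa [sub_add_sub_cancel] at this }

/-- The quotient category `C / I`. -/
abbrev QuotientCat (I : LinearIdeal k C) := CategoryTheory.Quotient I.homRel

lemma homRel_add (I : LinearIdeal k C) ⦃x y : C⦄ (f₁ f₂ g₁ g₂ : x ⟶ y)
    (hf : I.homRel f₁ f₂) (hg : I.homRel g₁ g₂) : I.homRel (f₁ + g₁) (f₂ + g₂) := by
  have := Submodule.add_mem _ hf hg
  rwa [← add_sub_add_comm] at this

lemma homRel_smul (I : LinearIdeal k C) (a : k) ⦃x y : C⦄ (f g : x ⟶ y)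
    (h : I.homRel f g) : I.homRel (a • f) (a • g) := by
  have := Submodule.smul_mem _ a h
  rwa [smul_sub] at this

noncomputable instance (I : LinearIdeal k C) : Preadditive I.QuotientCat :=
  CategoryTheory.Quotient.preadditive _ I.homRel_add

instance (I : LinearIdeal k C) : (CategoryTheory.Quotient.functor I.homRel).Additive :=
  CategoryTheory.Quotient.functor_additive _ I.homRel_add

noncomputable instance (I : LinearIdeal k C) : Linear k I.QuotientCat :=
  CategoryTheory.Quotient.linear k _ I.homRel_smul

instance (I : LinearIdeal k C) : (CategoryTheory.Quotient.functor I.homRel).Linear k :=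
  CategoryTheory.Quotient.linear_functor k _ I.homRel_smul

end LinearIdeal

/-- All spaces of morphisms of the `k`-linear category `A` are finite dimensional. -/
class HomFinite (k : Type u) [Field k] (A : Type v) [Category.{w} A] [Preadditive A]
    [Linear k A] : Prop where
  finite_hom : ∀ x y : A, FiniteDimensional k (x ⟶ y)

/-! ### Bound quivers -/

section BoundQuiver

variable (k : Type u) [Field k] (Q : Type v) [Quiver.{w} Q]

/-- The path category `kQ` : its objects are the vertices of `Q` and the morphisms from `x` to `y`
are the formal `k`-linear combinations of paths from `x` to `y`. -/
abbrev PathCat := Free k (Paths Q)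

variable {Q} in
/-- The path `α β` of length two, as a morphism of the path category. -/
noncomputable def pathTwo {x y z : Q} (α : x ⟶ y) (β : y ⟶ z) :
    ((Free.embedding k (Paths Q)).obj ((Paths.of Q).obj x) ⟶
      (Free.embedding k (Paths Q)).obj ((Paths.of Q).obj z)) :=
  (Free.embedding k (Paths Q)).map ((Paths.of Q).map α ≫ (Paths.of Q).map β)

/-- The ideal of `kQ` generated by all paths of length two. -/
noncomputable def squareIdeal : LinearIdeal k (PathCat k Q) :=
  LinearIdeal.span (C := PathCat k Q) fun (x z : Q) =>
    {p | ∃ (y : Q) (α : x ⟶ y) (β : y ⟶ z), p = pathTwo k α β}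

variable {k Q}

/-- `(Q, I)` is a bound quiver: the ideal `I` of `kQ` lies in the ideal generated by
the paths of length two, and all the spaces `kQ(x, y) / I(x, y)` are finite dimensional. -/
class IsBoundQuiver (I : LinearIdeal k (PathCat k Q)) : Prop where
  le_square : ∀ x y : PathCat k Q, I.carrier x y ≤ (squareIdeal k Q).carrier x y
  finite_quotient : ∀ x y : PathCat k Q, FiniteDimensional k ((x ⟶ y) ⧸ I.carrier x y)

instance (I : LinearIdeal k (PathCat k Q)) [IsBoundQuiver I] : HomFinite k I.QuotientCat where
  finite_hom x y := by
    let F := CategoryTheory.Quotient.functor I.homRel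
    have := IsBoundQuiver.finite_quotient (I := I) x.as y.as
    let φ : (x.as ⟶ y.as) →ₗ[k] (F.obj x.as ⟶ F.obj y.as) := F.mapLinearMap k
    have hφ : I.carrier x.as y.as ≤ LinearMap.ker φ := fun f hf => by
      have h : F.map f = F.map 0 := CategoryTheory.Quotient.sound _ (by
        change f - 0 ∈ _
        rwa [sub_zero])
      rw [LinearMap.mem_ker]
      exact h.trans (F.map_zero _ _)
    have hs : Function.Surjective ((I.carrier x.as y.as).liftQ φ hφ) := fun g => by
      obtain ⟨f, hf⟩ := F.map_surjective (X := x.as) (Y := y.as) g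
      exact ⟨Submodule.Quotient.mk f, hf⟩
    exact Module.Finite.of_surjective _ hs

end BoundQuiver

/-! ### Locally finite dimensional representations -/

section Representations

variable (k : Type u) [Field k] (A : Type v) [Category.{w} A] [Preadditive A] [Linear k A]

/-- `M : A ⥤ Mod k` is a `k`-linear functor with values in finite dimensional spaces. -/
structure IsLocFinRep (M : A ⥤ ModuleCat.{t} k) : Prop where
  additive : M.Additive
  linear : M.Linear k
  finite : ∀ x : A, FiniteDimensional k (M.obj x)

/-- The property of being a locally finite dimensional representation of `A`. -/
def locFinRep : ObjectProperty (A ⥤ ModuleCat.{t} k) := fun M => IsLocFinRep k A M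

instance : (locFinRep.{u, v, w, t} k A).IsClosedUnderSubobjects where
  prop_of_mono {M N} i hi hN := by
    obtain ⟨h₁, h₂, h₃⟩ := hN
    have hm : ∀ x, Mono (i.app x) := fun x => inferInstance
    refine ⟨⟨fun {x y f g} => ?_⟩, ⟨fun {x y} f r => ?_⟩, fun x => ?_⟩
    · rw [← cancel_mono (i.app y), Preadditive.add_comp, i.naturality, i.naturality,
        i.naturality, N.map_add, Preadditive.comp_add]
    · rw [← cancel_mono (i.app y), Linear.smul_comp, i.naturality, i.naturality,
        Functor.Linear.map_smul, Linear.comp_smul]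
    · have := h₃ x
      exact Module.Finite.of_injective (i.app x).hom ((ModuleCat.mono_iff_injective _).1 (hm x))

instance : (locFinRep.{u, v, w, t} k A).IsClosedUnderQuotients where
  prop_of_epi {M N} p hp hM := by
    obtain ⟨h₁, h₂, h₃⟩ := hM
    have hm : ∀ x, Epi (p.app x) := fun x => inferInstance
    refine ⟨⟨fun {x y f g} => ?_⟩, ⟨fun {x y} f r => ?_⟩, fun x => ?_⟩
    · rw [← cancel_epi (p.app x), Preadditive.comp_add, ← p.naturality, ← p.naturality,
        ← p.naturality, M.map_add, Preadditive.add_comp]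
    · rw [← cancel_epi (p.app x), Linear.comp_smul, ← p.naturality, ← p.naturality,
        Functor.Linear.map_smul, Linear.smul_comp]
    · have := h₃ x
      exact Module.Finite.of_surjective (p.app x).hom ((ModuleCat.epi_iff_surjective _).1 (hm x))

instance : (locFinRep.{u, v, w, t} k A).ContainsZero where
  exists_zero := by
    have hs : ∀ x, IsZero (((Functor.const A).obj (ModuleCat.of k PUnit.{t + 1})).obj x) :=
      fun _ => ModuleCat.isZero_of_subsingleton (ModuleCat.of k PUnit.{t + 1})
    have hz : IsZero ((Functor.const A).obj (ModuleCat.of k PUnit.{t + 1})) :=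
      (Functor.isZero_iff _).2 hs
    refine ⟨_, hz, ⟨fun {x y f g} => ?_⟩, ⟨fun {x y} f r => ?_⟩, fun x => ?_⟩
    · exact (hs x).eq_of_src _ _
    · exact (hs x).eq_of_src _ _
    · exact inferInstanceAs (Module.Finite k PUnit.{t + 1})

lemma locFinRep_biprod {M N : A ⥤ ModuleCat.{t} k} (hM : locFinRep k A M)
    (hN : locFinRep k A N) : locFinRep k A (M ⊞ N) := by
  obtain ⟨h₁, h₂, h₃⟩ := hM
  obtain ⟨l₁, l₂, l₃⟩ := hN
  have key : ∀ x, (biprod.fst : M ⊞ N ⟶ M).app x ≫ (biprod.inl : M ⟶ M ⊞ N).app x +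
      (biprod.snd : M ⊞ N ⟶ N).app x ≫ (biprod.inr : N ⟶ M ⊞ N).app x =
        𝟙 ((M ⊞ N).obj x) := fun x =>
    congrArg (fun φ => φ.app x) (biprod.total (X := M) (Y := N))
  have ext : ∀ {x y : A} (a b : (M ⊞ N).obj x ⟶ (M ⊞ N).obj y),
      a ≫ (biprod.fst : M ⊞ N ⟶ M).app y = b ≫ (biprod.fst : M ⊞ N ⟶ M).app y →
      a ≫ (biprod.snd : M ⊞ N ⟶ N).app y = b ≫ (biprod.snd : M ⊞ N ⟶ N).app y → a = b := by
    intro x y a b hf hs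
    rw [← Category.comp_id a, ← Category.comp_id b, ← key y, Preadditive.comp_add,
      Preadditive.comp_add, reassoc_of% hf, reassoc_of% hs]
  refine ⟨⟨fun {x y f g} => ?_⟩, ⟨fun {x y} f r => ?_⟩, fun x => ?_⟩
  · apply ext <;> simp [Preadditive.add_comp, M.map_add, N.map_add, Preadditive.comp_add]
  · apply ext <;> simp [Linear.smul_comp, M.map_smul, N.map_smul, Linear.comp_smul]
  · have := h₃ x
    have := l₃ x
    let φ : (M ⊞ N).obj x →ₗ[k] M.obj x × N.obj x :=
      ((biprod.fst : M ⊞ N ⟶ M).app x).hom.prod ((biprod.snd : M ⊞ N ⟶ N).app x).hom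
    refine Module.Finite.of_injective φ ((injective_iff_map_eq_zero φ).2 fun z hz => ?_)
    have e₁ : ((biprod.fst : M ⊞ N ⟶ M).app x).hom z = 0 := congrArg Prod.fst hz
    have e₂ : ((biprod.snd : M ⊞ N ⟶ N).app x).hom z = 0 := congrArg Prod.snd hz
    have e₃ := congrArg (fun ψ => ψ.hom z) (key x)
    simpa [e₁, e₂] using e₃.symm

instance : (locFinRep.{u, v, w, t} k A).IsClosedUnderBinaryProducts where
  limitsOfShape_le := by
    rintro X ⟨p⟩
    have e : X ≅ p.diag.obj ⟨.left⟩ ⊞ p.diag.obj ⟨.right⟩ :=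
      p.isLimit.conePointUniqueUpToIso (limit.isLimit p.diag) ≪≫
        HasLimit.isoOfNatIso (diagramIsoPair p.diag) ≪≫ (biprod.isoProd _ _).symm
    exact (locFinRep k A).prop_of_iso e.symm
      (locFinRep_biprod k A (p.prop_diag_obj _) (p.prop_diag_obj _))

instance : (locFinRep.{u, v, w, t} k A).IsClosedUnderFiniteProducts :=
  ObjectProperty.IsClosedUnderFiniteProducts.mk'

end Representations

/-! ### Representations of bound quivers -/

section BoundRep

variable {k : Type u} [Field k] {Q : Type v} [Quiver.{w} Q]

/-- The category `rep(Q, I)` of locally finite dimensional representations of `(Q, I)`: the full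
subcategory of the category of functors `kQ / I ⥤ Mod k` whose objects are the `k`-linear functors
with finite dimensional values. -/
abbrev BoundRep (I : LinearIdeal k (PathCat k Q)) :=
  (locFinRep.{u, v, max u v w, max u v w} k I.QuotientCat).FullSubcategory

noncomputable instance (I : LinearIdeal k (PathCat k Q)) : Abelian (BoundRep I) :=
  inferInstance

instance (I : LinearIdeal k (PathCat k Q)) : HasFiniteBiproducts (BoundRep I) :=
  Abelian.hasFiniteBiproducts

variable (I : LinearIdeal k (PathCat k Q))

/-- The vertex `x` of `Q` as an object of `kQ / I`. -/
noncomputable def vertex (x : Q) : I.QuotientCat :=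
  (CategoryTheory.Quotient.functor I.homRel).obj
    ((Free.embedding k (Paths Q)).obj ((Paths.of Q).obj x))

variable [IsBoundQuiver I]

/-- The representation `P_x = (kQ / I)(x, -)`. -/
noncomputable def projRep (x : Q) : BoundRep I :=
  ⟨(linearCoyoneda k I.QuotientCat).obj (Opposite.op (vertex I x)),
    { additive := inferInstance
      linear := ⟨fun {y z} f r => by
        ext g
        exact Linear.comp_smul (vertex I x) y z g r f⟩
      finite := fun y => HomFinite.finite_hom (vertex I x) y }⟩

/-- The representation `I_x = D (kQ / I)(-, x)`, where `D` is the duality of vector spaces. -/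
noncomputable def injRep (x : Q) : BoundRep I :=
  ⟨{ obj := fun y => ModuleCat.of k (Module.Dual k (y ⟶ vertex I x))
     map := fun f => ModuleCat.ofHom (Linear.leftComp k (vertex I x) f).dualMap
     map_id := fun y => by ext φ : 2; apply LinearMap.ext; intro g; simp
     map_comp := fun f g => by ext φ : 2; apply LinearMap.ext; intro h; simp },
    { additive := ⟨fun {y z f g} => by ext φ : 2; apply LinearMap.ext; intro h; simp⟩
      linear := ⟨fun f r => by ext φ : 2; apply LinearMap.ext; intro h; simp⟩
      finite := fun y => by
        have := HomFinite.finite_hom (k := k) y (vertex I x)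
        exact inferInstanceAs (FiniteDimensional k (Module.Dual k (y ⟶ vertex I x))) }⟩

variable {I}

/-- `M` is a quotient of a finite direct sum of representations of the form `P_x`. -/
def IsFinGenerated (M : BoundRep I) : Prop :=
  ∃ (n : ℕ) (x : Fin n → Q) (f : (⨁ fun i => projRep I (x i)) ⟶ M), Epi f

/-- `M` is the target of an epimorphism with finitely generated kernel from a finite
direct sum of representations of the form `P_x`. -/
def IsFinPresented (M : BoundRep I) : Prop :=
  ∃ (n : ℕ) (x : Fin n → Q) (f : (⨁ fun i => projRep I (x i)) ⟶ M),
    Epi f ∧ IsFinGenerated (kernel f)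

/-- `M` embeds into a finite direct sum of representations of the form `I_x`. -/
def IsFinCogenerated (M : BoundRep I) : Prop :=
  ∃ (n : ℕ) (x : Fin n → Q) (f : M ⟶ ⨁ fun i => injRep I (x i)), Mono f

/-- `M` is the source of a monomorphism with finitely co-generated cokernel to a finite
direct sum of representations of the form `I_x`. -/
def IsFinCopresented (M : BoundRep I) : Prop :=
  ∃ (n : ℕ) (x : Fin n → Q) (f : M ⟶ ⨁ fun i => injRep I (x i)),
    Mono f ∧ IsFinCogenerated (cokernel f)

end BoundRep

/-! ### Almost split sequences -/

section AlmostSplit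

variable {C : Type v} [Category.{w} C]

/-- `f : E ⟶ M` is not a retraction, and every morphism to `M` that is not a retraction
factors through `f`. -/
def IsRightAlmostSplit {E M : C} (f : E ⟶ M) : Prop :=
  ¬ IsSplitEpi f ∧ ∀ (L : C) (g : L ⟶ M), ¬ IsSplitEpi g → ∃ h : L ⟶ E, h ≫ f = g

/-- `f : M ⟶ E` is not a section, and every morphism from `M` that is not a section
factors through `f`. -/
def IsLeftAlmostSplit {M E : C} (f : M ⟶ E) : Prop :=
  ¬ IsSplitMono f ∧ ∀ (L : C) (g : M ⟶ L), ¬ IsSplitMono g → ∃ h : E ⟶ L, f ≫ h = g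

/-- A non-split short exact sequence `0 ⟶ X₁ ⟶ X₂ ⟶ X₃ ⟶ 0` in an abelian category with
indecomposable end terms, whose first map is left almost split and whose second map is
right almost split. -/
structure IsAlmostSplitSequence [Abelian C] (S : ShortComplex C) : Prop where
  shortExact : S.ShortExact
  not_split : IsEmpty S.Splitting
  indecomposable_left : Indecomposable S.X₁
  indecomposable_right : Indecomposable S.X₃
  left_almost_split : IsLeftAlmostSplit S.f
  right_almost_split : IsRightAlmostSplit S.g

end AlmostSplit

/-! Everything is deduced from one formal property of the families P_x and I_x. Evaluation at the
identity of x is a functional on Hom(P_x, I_x) that makes Hom(P_x, M) and Hom(M, I_x) dual finite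
dimensional spaces. `NakayamaDuality` records this together with the projectivity and density of the
P_x. The structure is self-dual (`NakayamaDuality.op`), so the second half of the theorem is the
first half in the opposite category.

Existence. Let M be the cokernel of a matrix r from ⊕P_{y_j} to ⊕P_{x_i}, and let ν be the
transposed matrix from ⊕I_{y_j} to ⊕I_{x_i}. Dualising the left exact sequence Hom(-, N) of the
presentation shows that D Hom(M, N) is the cokernel of Hom(N, ν) (`exists_factor_iff`). The ring
End(M) is local, by a Fitting argument carried out on each Hom(P_x, M), so some functional φ kills
the non-units but not the identity. Represent φ by a morphism from M to ⊕I_{x_i} and pull ν back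
along it. A morphism a to M lifts to the pullback exactly when φ(ba) = 0 for all b, which holds when
a is not a retraction and fails for the identity. The projection to M is thus right almost split; it
is epi because M is not projective. Its kernel is cogenerated by finitely many I_{y_j}, so
minimising the total dimension at the y_j yields a minimal version (`exists_minimal`), and the
kernel of a minimal one is left almost split.

Necessity. Let g : E ⟶ M be right almost split. If M is not finitely presented, no morphism from a
finitely presented object to M is a retraction, so all of them factor through g. Hence g has
sections over every finite system of generators and relations, and linear compactness of the finite
dimensional spaces Hom(P_x, E) assembles them into a section, a contradiction
(`isSplitEpi_of_partial_sections`). -/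

/-! ### The opposite of a linear category -/

section OppositeLinear

variable {k : Type u} [Field k] {C : Type v} [Category.{w} C] [Preadditive C] [Linear k C]

/-- The opposite of a linear category is linear. -/
instance oppositeLinear : Linear k Cᵒᵖ where
  homModule X Y :=
    { smul := fun a f => (a • f.unop).op
      one_smul := fun f => Quiver.Hom.unop_inj (one_smul k f.unop)
      mul_smul := fun a b f => Quiver.Hom.unop_inj (mul_smul a b f.unop)
      smul_zero := fun a => Quiver.Hom.unop_inj (smul_zero (A := Y.unop ⟶ X.unop) a)
      smul_add := fun a f g => Quiver.Hom.unop_inj (smul_add a f.unop g.unop)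
      add_smul := fun a b f => Quiver.Hom.unop_inj (add_smul a b f.unop)
      zero_smul := fun f => Quiver.Hom.unop_inj (zero_smul k f.unop) }
  smul_comp _ _ _ r f g := Quiver.Hom.unop_inj (Linear.comp_smul _ _ _ g.unop r f.unop)
  comp_smul _ _ _ f r g := Quiver.Hom.unop_inj (Linear.smul_comp _ _ _ r g.unop f.unop)

variable (k) in
/-- Passing to the opposite morphism, as a linear equivalence. -/
def opLinearEquiv (X Y : C) : (X ⟶ Y) ≃ₗ[k] (Opposite.op Y ⟶ Opposite.op X) where
  toFun f := f.op
  invFun f := f.unop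
  map_add' _ _ := rfl
  map_smul' _ _ := rfl
  left_inv _ := rfl
  right_inv _ := rfl

end OppositeLinear

/-! ### Linear algebra -/

section LinearAlgebra

variable {k : Type u} [Field k]

/-- A functional vanishing on the kernel of a linear map factors through that map. -/
lemma exists_functional_comp {V : Type v} {W : Type w} [AddCommGroup V] [Module k V]
    [AddCommGroup W] [Module k W] (T : V →ₗ[k] W) (φ : V →ₗ[k] k)
    (h : ∀ v, T v = 0 → φ v = 0) : ∃ ψ : W →ₗ[k] k, ∀ v, ψ (T v) = φ v := by
  have : φ ∈ LinearMap.range T.dualMap := by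
    rw [LinearMap.range_dualMap_eq_dualAnnihilator_ker, Submodule.mem_dualAnnihilator]
    exact fun v hv => h v hv
  obtain ⟨ψ, hψ⟩ := this
  exact ⟨ψ, fun v => LinearMap.congr_fun hψ v⟩

/-- The eventual image of an endomorphism. -/
def eventualRange {V : Type v} [AddCommGroup V] [Module k V] (f : V →ₗ[k] V) : Submodule k V :=
  ⨅ n : ℕ, LinearMap.range (f ^ n)

/-- The eventual kernel of an endomorphism. -/
def eventualKer {V : Type v} [AddCommGroup V] [Module k V] (f : V →ₗ[k] V) : Submodule k V :=
  ⨆ n : ℕ, LinearMap.ker (f ^ n)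

section

variable {V : Type v} [AddCommGroup V] [Module k V]

lemma mem_eventualRange {f : V →ₗ[k] V} {v : V} :
    v ∈ eventualRange f ↔ ∀ n : ℕ, ∃ z, (f ^ n) z = v := by
  simp [eventualRange, Submodule.mem_iInf]

lemma mem_eventualKer {f : V →ₗ[k] V} {v : V} :
    v ∈ eventualKer f ↔ ∃ n : ℕ, (f ^ n) v = 0 := by
  rw [eventualKer, Submodule.mem_iSup_of_directed]
  · simp
  · refine Monotone.directed_le fun a b hab z hz => ?_
    obtain ⟨c, rfl⟩ := Nat.exists_eq_add_of_le hab
    rw [LinearMap.mem_ker] at hz ⊢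
    rw [add_comm, pow_add, Module.End.mul_apply, hz, map_zero]

lemma isCompl_eventualKer_eventualRange [FiniteDimensional k V] (f : V →ₗ[k] V) :
    IsCompl (eventualKer f) (eventualRange f) :=
  f.isCompl_iSup_ker_pow_iInf_range_pow

/-- The Fitting projector: the projection onto the eventual image along the eventual kernel. -/
lemma exists_fittingProjector [FiniteDimensional k V] (f : V →ₗ[k] V) :
    ∃ e : V →ₗ[k] V, (∀ v, e v ∈ eventualRange f) ∧ ∀ v, v - e v ∈ eventualKer f := by
  have h := (isCompl_eventualKer_eventualRange f).symm
  refine ⟨(eventualRange f).subtype ∘ₗ Submodule.projectionOnto _ _ h,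
    fun v => (Submodule.projectionOnto _ _ h v).2, fun v => ?_⟩
  have := Submodule.projectionOnto_apply_eq_zero_iff h
    (x := v - (Submodule.projectionOnto _ _ h v : V))
  refine this.1 ?_
  rw [map_sub, Submodule.projectionOnto_apply_left, sub_self]

end

/-- A system of linear equations for a family of vectors in finite dimensional spaces, each
involving finitely many members of the family, is soluble if its finite subsystems are. -/
lemma exists_solution_of_finite_subsystems {J : Type v} {E : Type w} {V : J → Type t}
    [∀ j, AddCommGroup (V j)] [∀ j, Module k (V j)] [∀ j, FiniteDimensional k (V j)]
    (L : E → ((∀ j, V j) →ₗ[k] k)) (b : E → k)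
    (hL : ∀ i, ∃ S : Finset J, ∀ s : ∀ j, V j, (∀ j ∈ S, s j = 0) → L i s = 0)
    (hb : ∀ T : Finset E, ∃ s : ∀ j, V j, ∀ i ∈ T, L i s = b i) :
    ∃ s : ∀ j, V j, ∀ i, L i s = b i := by
  classical
  -- The assignment L i ↦ b i is well defined on the span of the L i: a linear relation involves
  -- finitely many equations, and these have a common solution.
  obtain ⟨φ, hφ⟩ := exists_functional_comp (Finsupp.linearCombination k L)
    (Finsupp.linearCombination k b) (fun c hc => by
      obtain ⟨s, hs⟩ := hb c.support
      have := LinearMap.congr_fun hc s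
      simp only [Finsupp.linearCombination_apply, Finsupp.sum, LinearMap.sum_apply,
        LinearMap.smul_apply, LinearMap.zero_apply] at this ⊢
      rw [← this]
      exact Finset.sum_congr rfl fun i hi => by rw [hs i hi])
  -- On functionals of the j-th coordinate alone, φ is evaluation at a vector, since V j is
  -- reflexive.
  let s : ∀ j, V j := fun j => (Module.evalEquiv k (V j)).symm
    (φ ∘ₗ (LinearMap.proj (R := k) (φ := V) j).dualMap)
  have key : ∀ (j : J) (ξ : Module.Dual k (V j)),
      φ (ξ ∘ₗ LinearMap.proj (R := k) (φ := V) j) = ξ (s j) := fun j ξ => by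
    simp only [s, Module.apply_evalEquiv_symm_apply]
    rfl
  have main : ∀ i, L i s = φ (L i) := fun i => by
    obtain ⟨S, hS⟩ := hL i
    -- Finite support is essential here: only finite sums of coordinate functionals are known to be
    -- evaluated at s by φ.
    have e : L i = ∑ j ∈ S, (L i ∘ₗ LinearMap.single k V j) ∘ₗ LinearMap.proj j := by
      ext z
      have h0 : L i (z - ∑ j ∈ S, Pi.single j (z j)) = 0 := hS _ fun j hj => by
        rw [Pi.sub_apply, Finset.sum_apply, Finset.sum_eq_single j]
        · simp
        · intro a _ ha
          exact Pi.single_eq_of_ne (Ne.symm ha) _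
        · exact fun h => absurd hj h
      rw [map_sub, map_sum, sub_eq_zero] at h0
      simpa using h0
    rw [e, map_sum]
    simp only [LinearMap.sum_apply, key]
    rfl
  refine ⟨s, fun i => ?_⟩
  rw [main]
  simpa using hφ (Finsupp.single i 1)

end LinearAlgebra

/-! ### Nakayama dualities -/

/-- Two families `P` and `I` of objects of a `k`-linear abelian category form a Nakayama duality
if the `P x` are projective, detect morphisms and form a dense subcategory, the spaces
`Hom (P x, M)` are finite dimensional, and there are functionals on the spaces `Hom (P x, I x)`
which make the pairings of `Hom (P x, M)` and `Hom (M, I x)` perfect. -/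
structure NakayamaDuality (k : Type u) [Field k] {C : Type v} [Category.{w} C] [Abelian C]
    [Linear k C] {X : Type t} (P I : X → C) where
  /-- the trace functional -/
  tr : ∀ x, (P x ⟶ I x) →ₗ[k] k
  finite : ∀ x M, FiniteDimensional k (P x ⟶ M)
  projective : ∀ x, Projective (P x)
  separating : ∀ {M N : C} (f : M ⟶ N), (∀ x (p : P x ⟶ M), p ≫ f = 0) → f = 0
  represent : ∀ {x M} (φ : (P x ⟶ M) →ₗ[k] k), ∃ f : M ⟶ I x, ∀ p, tr x (p ≫ f) = φ p
  eq_zero_right : ∀ {x M} (f : M ⟶ I x), (∀ p, tr x (p ≫ f) = 0) → f = 0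
  dense : ∀ {M N : C} (s : ∀ x, (P x ⟶ M) →ₗ[k] (P x ⟶ N)),
    (∀ x y (r : P y ⟶ P x) p, s y (r ≫ p) = r ≫ s x p) →
    ∃ f : M ⟶ N, ∀ x p, p ≫ f = s x p

namespace NakayamaDuality

variable {k : Type u} [Field k] {C : Type v} [Category.{w} C] [Abelian C]
    [Linear k C] {X : Type t} {P I : X → C} (D : NakayamaDuality k P I)

include D

lemma eq_zero_left {x : X} {M : C} (p : P x ⟶ M)
    (h : ∀ f, D.tr x (p ≫ f) = 0) : p = 0 := by
  refine (Module.forall_dual_apply_eq_zero_iff k p).1 fun φ => ?_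
  obtain ⟨f, hf⟩ := D.represent φ
  rw [← hf, h]

lemma eq_of_right {x : X} {M : C} {f g : M ⟶ I x}
    (h : ∀ p, D.tr x (p ≫ f) = D.tr x (p ≫ g)) : f = g := by
  refine sub_eq_zero.1 (D.eq_zero_right _ fun p => ?_)
  rw [Preadditive.comp_sub, map_sub, h, sub_self]

lemma eq_of_left {x : X} {M : C} {p q : P x ⟶ M}
    (h : ∀ f, D.tr x (p ≫ f) = D.tr x (q ≫ f)) : p = q := by
  refine sub_eq_zero.1 (D.eq_zero_left _ fun f => ?_)
  rw [Preadditive.sub_comp, map_sub, h, sub_self]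

lemma hom_ext {M N : C} {f g : M ⟶ N} (h : ∀ x (p : P x ⟶ M), p ≫ f = p ≫ g) : f = g := by
  refine sub_eq_zero.1 (D.separating _ fun x p => ?_)
  rw [Preadditive.comp_sub, h, sub_self]

/-- The Nakayama functor on morphisms. -/
lemma exists_nakayama {x y : X} (r : P y ⟶ P x) :
    ∃ ν : I y ⟶ I x, ∀ {M : C} (p : P x ⟶ M) (f : M ⟶ I y),
      D.tr x (p ≫ f ≫ ν) = D.tr y (r ≫ p ≫ f) := by
  obtain ⟨ν, hν⟩ := D.represent (M := I y) (D.tr y ∘ₗ Linear.leftComp k (I y) r)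
  refine ⟨ν, fun p f => ?_⟩
  rw [← Category.assoc, hν]
  simp

/-- The pairing as a linear map to the dual space. -/
def pairing (x : X) (M : C) : (P x ⟶ M) →ₗ[k] Module.Dual k (M ⟶ I x) :=
  LinearMap.mk₂ k (fun p f => D.tr x (p ≫ f)) (by simp) (by simp) (by simp) (by simp)

@[simp] lemma pairing_apply {x : X} {M : C} (p : P x ⟶ M) (f : M ⟶ I x) :
    D.pairing x M p f = D.tr x (p ≫ f) := rfl

lemma flip_pairing_injective (x : X) (M : C) : Function.Injective (D.pairing x M).flip :=
  (injective_iff_map_eq_zero _).2 fun f hf =>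
    D.eq_zero_right f fun p => LinearMap.congr_fun hf p

lemma pairing_injective (x : X) (M : C) : Function.Injective (D.pairing x M) :=
  (injective_iff_map_eq_zero _).2 fun p hp =>
    D.eq_zero_left p fun f => LinearMap.congr_fun hp f

lemma finite_hom_right (M : C) (x : X) : FiniteDimensional k (M ⟶ I x) := by
  have := D.finite x M
  exact Module.Finite.of_injective _ (D.flip_pairing_injective x M)

/-- Both spaces embed in the dual of the other, so their dimensions agree. -/
lemma pairing_surjective (x : X) (M : C) : Function.Surjective (D.pairing x M) := by
  have := D.finite x M
  have := D.finite_hom_right M x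
  have h₁ := LinearMap.finrank_le_finrank_of_injective (D.flip_pairing_injective x M)
  have h₂ := LinearMap.finrank_le_finrank_of_injective (D.pairing_injective x M)
  rw [Subspace.dual_finrank_eq] at h₁ h₂
  refine (LinearMap.injective_iff_surjective_of_finrank_eq_finrank ?_).1 (D.pairing_injective x M)
  rw [Subspace.dual_finrank_eq]
  exact le_antisymm h₂ h₁

lemma coseparating {M N : C} (f : M ⟶ N) (h : ∀ x (q : N ⟶ I x), f ≫ q = 0) : f = 0 :=
  D.separating f fun x p => D.eq_zero_left _ fun q => by simp [h]

/-- Hom(-, I x) is the dual of Hom(P x, -), which preserves monomorphisms; functionals extend along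
injections. -/
lemma injective (x : X) : Injective (I x) where
  factors {M N} g f hf := by
    obtain ⟨φ, hφ⟩ := exists_functional_comp (Linear.rightComp k (P x) f)
      (D.pairing x M |>.flip g) (fun p hp => by
        have : p ≫ f = 0 := hp
        have : p = 0 := by rwa [← cancel_mono f, zero_comp]
        simp [this])
    obtain ⟨q, hq⟩ := D.represent φ
    refine ⟨q, D.eq_of_right fun p => ?_⟩
    rw [← Category.assoc, hq]
    exact hφ p

/-- Transposing along the perfect pairings reduces this to density of the P x; compatibility with
morphisms between the P x is compatibility of s with their Nakayama images. -/
lemma codense {M N : C} (s : ∀ x, (M ⟶ I x) →ₗ[k] (N ⟶ I x))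
    (hs : ∀ x y (r : I x ⟶ I y) q, s y (q ≫ r) = s x q ≫ r) :
    ∃ f : N ⟶ M, ∀ x q, f ≫ q = s x q := by
  have h : ∀ x, ∃ a : (P x ⟶ N) →ₗ[k] (P x ⟶ M), ∀ p q,
      D.tr x (a p ≫ q) = D.tr x (p ≫ s x q) := fun x => by
    let e := LinearEquiv.ofBijective _ ⟨D.pairing_injective x M, D.pairing_surjective x M⟩
    refine ⟨e.symm.toLinearMap ∘ₗ (s x).dualMap ∘ₗ D.pairing x N, fun p q => ?_⟩
    exact LinearMap.congr_fun (e.apply_symm_apply ((s x).dualMap (D.pairing x N p))) q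
  choose a ha using h
  obtain ⟨f, hf⟩ := D.dense a (fun x y r p => D.eq_of_left fun q => by
    obtain ⟨ν, hν⟩ := D.exists_nakayama r
    rw [ha, Category.assoc, Category.assoc, ← hν, ← hs, ← ha, ← hν])
  exact ⟨f, fun x q => D.eq_of_right fun p => by rw [← Category.assoc, hf, ha]⟩

omit D in
/-- The opposite of a Nakayama duality. -/
noncomputable def op (D : NakayamaDuality k P I) :
    NakayamaDuality k (fun x => Opposite.op (I x)) (fun x => Opposite.op (P x)) where
  tr x := D.tr x ∘ₗ (opLinearEquiv k (P x) (I x)).symm.toLinearMap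
  finite x M := by
    have := D.finite_hom_right M.unop x
    exact Module.Finite.equiv (opLinearEquiv k M.unop (I x))
  projective x := by
    have := D.injective x
    infer_instance
  separating f h := Quiver.Hom.unop_inj (D.coseparating f.unop fun x q =>
    Quiver.Hom.op_inj (h x q.op))
  represent {x M} φ := by
    obtain ⟨p, hp⟩ := D.pairing_surjective x M.unop
      (φ ∘ₗ (opLinearEquiv k M.unop (I x)).toLinearMap)
    exact ⟨p.op, fun q => LinearMap.congr_fun hp q.unop⟩
  eq_zero_right f h := Quiver.Hom.unop_inj (D.eq_zero_left f.unop fun q => h q.op)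
  dense {M N} s hs := by
    obtain ⟨f, hf⟩ := D.codense (M := M.unop) (N := N.unop)
      (fun x => (opLinearEquiv k N.unop (I x)).symm.toLinearMap ∘ₗ s x ∘ₗ
        (opLinearEquiv k M.unop (I x)).toLinearMap)
      (fun x y r q => congrArg Quiver.Hom.unop (hs x y r.op q.op))
    exact ⟨f.op, fun x p => congrArg Quiver.Hom.op (hf x p.unop)⟩

/-! ### Fitting decompositions of endomorphisms -/

/-- Postcomposition with an endomorphism, on the spaces of morphisms from the `P x`. -/
abbrev _root_.endoAct (k : Type u) [Field k] {C : Type v} [Category.{w} C] [Preadditive C]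
    [Linear k C] {M : C} (Z : C) (f : M ⟶ M) : (Z ⟶ M) →ₗ[k] (Z ⟶ M) :=
  Linear.rightComp k Z f

omit D in
lemma endoAct_pow_comp {M Z Z' : C} (f : M ⟶ M) (r : Z' ⟶ Z) (n : ℕ) (p : Z ⟶ M) :
    (endoAct k Z' f ^ n) (r ≫ p) = r ≫ (endoAct k Z f ^ n) p := by
  induction n generalizing p with
  | zero => simp
  | succ n ih => simp [pow_succ, Module.End.mul_apply, ih]

/-- The Fitting projector of an endomorphism. -/
lemma exists_fitting {M : C} (f : M ⟶ M) :
    ∃ e : M ⟶ M, ∀ x (p : P x ⟶ M), p ≫ e ∈ eventualRange (endoAct k (P x) f) ∧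
      p - p ≫ e ∈ eventualKer (endoAct k (P x) f) := by
  have h : ∀ x, ∃ e : (P x ⟶ M) →ₗ[k] (P x ⟶ M),
      (∀ v, e v ∈ eventualRange (endoAct k (P x) f)) ∧
        ∀ v, v - e v ∈ eventualKer (endoAct k (P x) f) := fun x => by
    have := D.finite x M
    exact exists_fittingProjector _
  choose e he₁ he₂ using h
  obtain ⟨E, hE⟩ := D.dense e (fun x y r p => by
    have := D.finite y M
    have hd := (isCompl_eventualKer_eventualRange (endoAct k (P y) f)).disjoint
    -- Precomposition with r preserves eventual kernels and images, so the defect of naturality lies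
    -- in both and vanishes. Density then glues the pointwise projectors.
    refine sub_eq_zero.1 (Submodule.disjoint_def.1 hd _ ?_ ?_)
    · have h₁ := he₂ y (r ≫ p)
      have h₂ : r ≫ (p - e x p) ∈ eventualKer (endoAct k (P y) f) := by
        obtain ⟨n, hn⟩ := mem_eventualKer.1 (he₂ x p)
        exact mem_eventualKer.2 ⟨n, by rw [endoAct_pow_comp, hn, comp_zero]⟩
      have := Submodule.sub_mem _ h₂ h₁
      rw [Preadditive.comp_sub] at this
      convert this using 1
      abel
    · refine Submodule.sub_mem _ (he₁ y _) (mem_eventualRange.2 fun n => ?_)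
      obtain ⟨z, hz⟩ := mem_eventualRange.1 (he₁ x p) n
      exact ⟨r ≫ z, by rw [endoAct_pow_comp, hz]⟩)
  exact ⟨E, fun x p => by rw [hE]; exact ⟨he₁ x p, he₂ x p⟩⟩

lemma fitting_idem {M : C} {f e : M ⟶ M}
    (he : ∀ x (p : P x ⟶ M), p ≫ e ∈ eventualRange (endoAct k (P x) f) ∧
      p - p ≫ e ∈ eventualKer (endoAct k (P x) f)) : e ≫ e = e := by
  refine D.hom_ext fun x p => ?_
  have := D.finite x M
  have hd := (isCompl_eventualKer_eventualRange (endoAct k (P x) f)).disjoint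
  rw [← Category.assoc]
  refine (sub_eq_zero.1 (Submodule.disjoint_def.1 hd _ ?_ ?_)).symm
  · exact (he x (p ≫ e)).2
  · exact Submodule.sub_mem _ (he x _).1 (he x _).1

/-- An endomorphism is invertible if its Fitting projector is the identity. -/
lemma isIso_of_fitting {M : C} {f : M ⟶ M}
    (he : ∀ x (p : P x ⟶ M), p ∈ eventualRange (endoAct k (P x) f)) : IsIso f := by
  have hs : ∀ x, Function.Surjective (endoAct k (P x) f) := fun x p => by
    simpa using mem_eventualRange.1 (he x p) 1
  have hi : ∀ x, Function.Injective (endoAct k (P x) f) := fun x => by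
    have := D.finite x M
    exact LinearMap.injective_iff_surjective.2 (hs x)
  have : Mono f := Preadditive.mono_of_cancel_zero _ fun {N} g hg =>
    D.separating g fun x p => hi x (by simp [hg])
  have : Epi f := Preadditive.epi_of_cancel_zero _ fun {N} g hg =>
    D.separating g fun x p => by
      obtain ⟨q, hq⟩ := hs x p
      rw [← hq]
      simp [hg]
  exact isIso_of_mono_of_epi f

end NakayamaDuality

/-! ### Matrix presentations -/

section Presentations

variable {C : Type v} [Category.{w} C] [Preadditive C] {X : Type t} {P : X → C}

/-- The family of morphisms from `Z` whose only non-zero member is `r : Z ⟶ Y l`. -/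
noncomputable def singleHom {ι : Type*} {Y : ι → C} {Z : C} (l : ι) (r : Z ⟶ Y l) (i : ι) :
    Z ⟶ Y i :=
  open Classical in Pi.single (M := fun i => Z ⟶ Y i) l r i

lemma sum_singleHom_comp {ι : Type*} {Y : ι → C} {Z N : C} (S : Finset ι) {l : ι} (hl : l ∈ S)
    (r : Z ⟶ Y l) (z : ∀ i, Y i ⟶ N) : ∑ i ∈ S, singleHom l r i ≫ z i = r ≫ z l := by
  classical
  rw [Finset.sum_eq_single l]
  · simp [singleHom]
  · intro i _ hi
    simp [singleHom, Pi.single_eq_of_ne hi]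
  · exact fun h => absurd hl h

/-- The morphisms `p i` present `M` as the cokernel of the matrix `r` of morphisms between the
objects `P (y j)` and `P (x i)`. -/
structure IsMatrixPresentation {ι κ : Type} [Fintype ι] [Fintype κ] {x : ι → X} {y : κ → X}
    (r : ∀ j i, P (y j) ⟶ P (x i)) {M : C} (p : ∀ i, P (x i) ⟶ M) : Prop where
  relation : ∀ j, ∑ i, r j i ≫ p i = 0
  jointly_epi : ∀ {N : C} (h : M ⟶ N), (∀ i, p i ≫ h = 0) → h = 0
  exists_desc : ∀ {N : C} (h : ∀ i, P (x i) ⟶ N), (∀ j, ∑ i, r j i ≫ h i = 0) →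
    ∃ t : M ⟶ N, ∀ i, p i ≫ t = h i

variable (P) in
/-- `M` is the cokernel of a finite matrix of morphisms between members of the family `P`. -/
def IsMatrixPresented (M : C) : Prop :=
  ∃ (n m : ℕ) (x : Fin n → X) (y : Fin m → X) (r : ∀ j i, P (y j) ⟶ P (x i))
    (p : ∀ i, P (x i) ⟶ M), IsMatrixPresentation r p

lemma IsMatrixPresentation.isMatrixPresented {ι κ : Type} [Fintype ι] [Fintype κ] {x : ι → X}
    {y : κ → X} {r : ∀ j i, P (y j) ⟶ P (x i)} {M : C} {p : ∀ i, P (x i) ⟶ M}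
    (h : IsMatrixPresentation r p) : IsMatrixPresented P M := by
  let a := (Fintype.equivFin ι).symm
  let b := (Fintype.equivFin κ).symm
  refine ⟨_, _, fun i => x (a i), fun j => y (b j), fun j i => r (b j) (a i), fun i => p (a i),
    fun j => ?_, fun {N} g hg => h.jointly_epi g fun i => ?_, fun {N} g hg => ?_⟩
  · rw [a.sum_comp (fun i => r (b j) i ≫ p i)]
    exact h.relation _
  · obtain ⟨i, rfl⟩ := a.surjective i
    exact hg i
  · let g' : ∀ i, P (x i) ⟶ N := Equiv.piCongrLeft (fun i => P (x i) ⟶ N) a g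
    have hg' : ∀ i, g' (a i) = g i := Equiv.piCongrLeft_apply_apply (fun i => P (x i) ⟶ N) a g
    obtain ⟨t, ht⟩ := h.exists_desc g' (fun j => by
      obtain ⟨j, rfl⟩ := b.surjective j
      rw [← a.sum_comp (fun i => r (b j) i ≫ g' i)]
      simpa [hg'] using hg j)
    exact ⟨t, fun i => by rw [ht, hg']⟩

end Presentations

/-! ### Cokernels of matrices and their retracts -/

section Abelian

variable {C : Type v} [Category.{w} C] [Abelian C] {X : Type t} {P : X → C}

lemma exists_isMatrixPresentation {ι κ : Type} [Fintype ι] [Fintype κ] {x : ι → X} {y : κ → X}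
    (r : ∀ j i, P (y j) ⟶ P (x i)) :
    ∃ (F : C) (p : ∀ i, P (x i) ⟶ F), IsMatrixPresentation r p := by
  classical
  have := Abelian.hasFiniteBiproducts (C := C)
  have key : ∀ {N : C} (h : ∀ i, P (x i) ⟶ N), biproduct.matrix r ≫ biproduct.desc h =
      biproduct.desc fun j => ∑ i, r j i ≫ h i := fun h => biproduct.matrix_desc r h
  refine ⟨cokernel (biproduct.matrix r), fun i => biproduct.ι (fun i => P (x i)) i ≫ cokernel.π _,
    fun j => ?_, fun {N} h hh => ?_, fun {N} h hh => ?_⟩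
  · have h₁ := key fun i => biproduct.ι (fun i => P (x i)) i ≫ cokernel.π (biproduct.matrix r)
    have h₂ : biproduct.desc (fun i => biproduct.ι (fun i => P (x i)) i ≫
        cokernel.π (biproduct.matrix r)) = cokernel.π (biproduct.matrix r) := by
      ext i; simp
    rw [h₂, cokernel.condition] at h₁
    simpa using (biproduct.ι _ j ≫= h₁).symm
  · rw [← cancel_epi (cokernel.π _), comp_zero]
    ext i
    simpa using hh i
  · have hz : biproduct.matrix r ≫ biproduct.desc h = 0 := by
      rw [key]
      ext j
      simp [hh]
    exact ⟨cokernel.desc _ (biproduct.desc h) hz, fun i => by simp⟩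

/-- Morphisms from a projective object lift along a finite jointly epimorphic family. -/
lemma exists_lift_of_jointly_epi {ι : Type} [Fintype ι] {Y : ι → C} {M : C} (p : ∀ i, Y i ⟶ M)
    (hp : ∀ {N : C} (h : M ⟶ N), (∀ i, p i ≫ h = 0) → h = 0) {Z : C} (hZ : Projective Z)
    (q : Z ⟶ M) : ∃ c : ∀ i, Z ⟶ Y i, ∑ i, c i ≫ p i = q := by
  classical
  have := Abelian.hasFiniteBiproducts (C := C)
  have : Epi (biproduct.desc p) := Preadditive.epi_of_cancel_zero _ fun {N} h hh => hp h fun i => by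
    simpa using biproduct.ι _ i ≫= hh
  refine ⟨fun i => Projective.factorThru q (biproduct.desc p) ≫ biproduct.π _ i, ?_⟩
  have h := Projective.factorThru_comp q (biproduct.desc p)
  generalize Projective.factorThru q (biproduct.desc p) = a at h ⊢
  rw [← h, biproduct.desc_eq, Preadditive.comp_sum]
  simp

/-- A retract of a finitely presented object is finitely presented. -/
lemma IsMatrixPresentation.isMatrixPresented_of_retract (hP : ∀ x, Projective (P x))
    {ι κ : Type} [Fintype ι] [Fintype κ] {x : ι → X}
    {y : κ → X} {r : ∀ j i, P (y j) ⟶ P (x i)} {F : C} {p : ∀ i, P (x i) ⟶ F}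
    (h : IsMatrixPresentation r p) {M : C} (a : M ⟶ F) (b : F ⟶ M) (hab : a ≫ b = 𝟙 M) :
    IsMatrixPresented P M := by
  classical
  have hc := fun i => exists_lift_of_jointly_epi p h.jointly_epi (hP (x i)) (p i ≫ b ≫ a)
  choose c hc using hc
  -- M is the cokernel of 1 - e for the idempotent e = `b ≫ a` of F. As c lifts e to the generators,
  -- it suffices to add the rows of 1 - c as relations.
  let c' : ∀ l i, P (x l) ⟶ P (x i) := fun l i =>
    singleHom (Y := fun i => P (x i)) l (𝟙 _) i - c l i
  have hr : ∀ {N : C} (q : ∀ i, P (x i) ⟶ N) (l : ι),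
      ∑ i, c' l i ≫ q i = q l - ∑ i, c l i ≫ q i := fun q l => by
    simp only [c', Preadditive.sub_comp, Finset.sum_sub_distrib]
    rw [sum_singleHom_comp (Y := fun i => P (x i)) _ (Finset.mem_univ l), Category.id_comp]
  let r' : ∀ (j : κ ⊕ ι) (i : ι), P (Sum.elim y x j) ⟶ P (x i) := fun j =>
    match j with
    | .inl j => r j
    | .inr l => c' l
  refine IsMatrixPresentation.isMatrixPresented (r := r') (p := fun i => p i ≫ b)
    ⟨?_, fun {N} g hg => ?_, fun {N} g hg => ?_⟩
  · rintro (j | l)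
    · have : ∑ i, r j i ≫ p i ≫ b = 0 := by
        simpa [Preadditive.sum_comp] using h.relation j =≫ b
      exact this
    · refine (hr (fun i => p i ≫ b) l).trans ?_
      have := hc l =≫ b
      simp only [Category.assoc, hab, Category.comp_id, Preadditive.sum_comp] at this
      exact sub_eq_zero.2 this.symm
  · have : b ≫ g = 0 := h.jointly_epi _ fun i => by simpa using hg i
    rw [← Category.id_comp g, ← hab, Category.assoc, this, comp_zero]
  · obtain ⟨t, ht⟩ := h.exists_desc g fun j => hg (.inl j)
    refine ⟨a ≫ t, fun i => ?_⟩
    have h₁ : ∑ j, c' i j ≫ g j = 0 := hg (.inr i)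
    rw [hr, sub_eq_zero] at h₁
    have h₂ := hc i =≫ t
    simp only [Category.assoc, Preadditive.sum_comp, ht] at h₂
    rw [Category.assoc, ← h₂, h₁]

end Abelian

/-! ### A compactness principle -/

namespace NakayamaDuality

variable {k : Type u} [Field k] {C : Type v} [Category.{w} C] [Abelian C]
    [Linear k C] {X : Type t} {P I : X → C} (D : NakayamaDuality k P I)

include D

/-- A morphism `g : E ⟶ M` is a retraction if it admits partial sections over all finite
systems of generators and relations in `M`. -/
lemma isSplitEpi_of_partial_sections {E M : C} (g : E ⟶ M)
    (h : ∀ (n m : ℕ) (x : Fin n → X) (y : Fin m → X) (r : ∀ j i, P (y j) ⟶ P (x i))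
      (p : ∀ i, P (x i) ⟶ M), (∀ j, ∑ i, r j i ≫ p i = 0) →
      ∃ e : ∀ i, P (x i) ⟶ E, (∀ j, ∑ i, r j i ≫ e i = 0) ∧ ∀ i, e i ≫ g = p i) :
    IsSplitEpi g := by
  classical
  -- The unknowns are a lift to E of each p : P x ⟶ M. The equations in A say that it lifts p, those
  -- in B that every finite relation among such p persists; testing against functionals makes all of
  -- them scalar.
  let J := Σ x, (P x ⟶ M)
  let V : J → Type w := fun j => P j.1 ⟶ E
  have : ∀ j, FiniteDimensional k (V j) := fun j => D.finite _ _
  let A := Σ j : J, Module.Dual k (P j.1 ⟶ M)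
  let R : X → Type _ := fun y => {R : Finset J × (∀ j : J, P y ⟶ P j.1) //
    ∑ j ∈ R.1, R.2 j ≫ j.2 = 0}
  let B := Σ y, R y × Module.Dual k (P y ⟶ E)
  let rel : ∀ y, R y → ((∀ j, V j) →ₗ[k] (P y ⟶ E)) := fun y ρ =>
    ∑ j ∈ ρ.1.1, Linear.leftComp k E (ρ.1.2 j) ∘ₗ LinearMap.proj j
  have rel_apply : ∀ y (ρ : R y) s, rel y ρ s = ∑ j ∈ ρ.1.1, ρ.1.2 j ≫ s j := fun y ρ s => by
    simp [rel]
  let L : A ⊕ B → ((∀ j, V j) →ₗ[k] k) := Sum.elim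
    (fun a => a.2 ∘ₗ Linear.rightComp k (P a.1.1) g ∘ₗ LinearMap.proj a.1)
    (fun b => b.2.2 ∘ₗ rel b.1 b.2.1)
  let β : A ⊕ B → k := Sum.elim (fun a => a.2 a.1.2) (fun _ => 0)
  let supp : A ⊕ B → Finset J := Sum.elim (fun a => {a.1}) (fun b => b.2.1.1.1)
  obtain ⟨s, hs⟩ : ∃ s : ∀ j, V j, ∀ i, L i s = β i := by
    refine exists_solution_of_finite_subsystems L β (fun i => ⟨supp i, fun s hs => ?_⟩)
      fun T => ?_
    · rcases i with a | b
      · have : s a.1 = 0 := hs _ (by simp [supp])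
        simp [L, this]
      · have : rel b.1 b.2.1 s = 0 := by
          rw [rel_apply]
          exact Finset.sum_eq_zero fun j hj => by rw [hs j hj]; exact comp_zero
        simp [L, this]
    -- A finite subsystem involves finitely many p and finitely many relations among them, so the
    -- hypothesis solves it; the unknowns outside S are set to zero.
    · let S := T.biUnion supp
      let T' := T.toRight
      let a := S.equivFin.symm
      let b := T'.equivFin.symm
      have hsum : ∀ {N : C} (z : ∀ j : J, P j.1 ⟶ N) (c : T'),
          ∑ i, (if (a i).1 ∈ c.1.2.1.1.1 then c.1.2.1.1.2 (a i).1 else 0) ≫ z (a i).1 =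
            ∑ j ∈ c.1.2.1.1.1, c.1.2.1.1.2 j ≫ z j := fun z c => by
        rw [a.sum_comp (fun j : S => (if j.1 ∈ c.1.2.1.1.1 then c.1.2.1.1.2 j.1 else 0) ≫ z j.1),
          Finset.sum_coe_sort S
            (fun j => (if j ∈ c.1.2.1.1.1 then c.1.2.1.1.2 j else 0) ≫ z j)]
        have hc : c.1.2.1.1.1 ⊆ S :=
          Finset.subset_biUnion_of_mem supp (x := Sum.inr c.1) (Finset.mem_toRight.1 c.2)
        rw [← Finset.sum_subset hc fun j _ hj => by simp [hj]]
        exact Finset.sum_congr rfl fun j hj => by simp [hj]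
      obtain ⟨e, he₁, he₂⟩ := h _ _ (fun i => (a i).1.1) (fun j => (b j).1.1)
        (fun j i => if (a i).1 ∈ (b j).1.2.1.1.1 then (b j).1.2.1.1.2 (a i).1 else 0)
        (fun i => (a i).1.2) (fun j => by
          rw [hsum (fun j => j.2) (b j)]
          exact (b j).1.2.1.2)
      let e' : ∀ j : S, V j.1 := Equiv.piCongrLeft (fun j : S => V j.1) a e
      have he' : ∀ i, e' (a i) = e i := Equiv.piCongrLeft_apply_apply (fun j : S => V j.1) a e
      let s : ∀ j, V j := fun j => if hj : j ∈ S then e' ⟨j, hj⟩ else 0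
      have hsa : ∀ i, s (a i).1 = e i := fun i => by
        simp only [s, dif_pos (a i).2, ← he']
      refine ⟨s, ?_⟩
      rintro (c | c) hc
      · have hS : c.1 ∈ S := Finset.mem_biUnion.2 ⟨_, hc, by simp [supp]⟩
        obtain ⟨i, hi⟩ := a.surjective ⟨c.1, hS⟩
        have : (s c.1 : P c.1.1 ⟶ E) ≫ g = c.1.2 := by
          have h₁ := hsa i
          have h₂ := he₂ i
          rw [← h₁, hi] at h₂
          exact h₂
        simp only [L, β, Sum.elim_inl, LinearMap.comp_apply, LinearMap.proj_apply]
        rw [Linear.rightComp_apply, this]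
      · have hT : c ∈ T' := Finset.mem_toRight.2 hc
        obtain ⟨j, hj⟩ := b.surjective ⟨c, hT⟩
        have h₁ := he₁ j
        simp only [← hsa] at h₁
        rw [hsum s (b j), hj] at h₁
        simp only [L, β, Sum.elim_inr, LinearMap.comp_apply, rel_apply, h₁, map_zero]
  have hs₁ : ∀ x (p : P x ⟶ M), (s ⟨x, p⟩ : P x ⟶ E) ≫ g = p := fun x p => by
    rw [← sub_eq_zero, ← Module.forall_dual_apply_eq_zero_iff k]
    intro ζ
    rw [map_sub, sub_eq_zero]
    exact hs (Sum.inl ⟨⟨x, p⟩, ζ⟩)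
  have hs₂ : ∀ y (ρ : R y), ∑ j ∈ ρ.1.1, ρ.1.2 j ≫ s j = 0 := fun y ρ => by
    rw [← Module.forall_dual_apply_eq_zero_iff k]
    intro ξ
    rw [← rel_apply]
    exact hs (Sum.inr ⟨y, ρ, ξ⟩)
  -- Additivity, homogeneity and naturality of s are all relations with at most three terms. Adding
  -- up the coefficients allows the indices to coincide.
  have hs₃ : ∀ {y : X} (j₁ j₂ j₃ : J) (r₁ : P y ⟶ P j₁.1) (r₂ : P y ⟶ P j₂.1)
      (r₃ : P y ⟶ P j₃.1), r₁ ≫ j₁.2 + r₂ ≫ j₂.2 + r₃ ≫ j₃.2 = 0 →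
      r₁ ≫ s j₁ + r₂ ≫ s j₂ + r₃ ≫ s j₃ = 0 := by
    intro y j₁ j₂ j₃ r₁ r₂ r₃ hr
    let Y : J → C := fun j => P j.1
    have key : ∀ {N : C} (z : ∀ j : J, P j.1 ⟶ N), ∑ i ∈ ({j₁, j₂, j₃} : Finset J),
        (singleHom (Y := Y) j₁ r₁ i + singleHom (Y := Y) j₂ r₂ i + singleHom (Y := Y) j₃ r₃ i) ≫ z i =
          r₁ ≫ z j₁ + r₂ ≫ z j₂ + r₃ ≫ z j₃ := by
      intro N z
      simp only [Preadditive.add_comp, Finset.sum_add_distrib]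
      rw [sum_singleHom_comp (Y := Y) _ (l := j₁) (by simp), sum_singleHom_comp (Y := Y) _ (l := j₂)
        (by simp), sum_singleHom_comp (Y := Y) _ (l := j₃) (by simp)]
    rw [← key s]
    exact hs₂ y ⟨⟨_, fun i => singleHom (Y := Y) j₁ r₁ i +
      singleHom (Y := Y) j₂ r₂ i + singleHom (Y := Y) j₃ r₃ i⟩, (key fun j => j.2).trans hr⟩
  have hadd : ∀ x (p q : P x ⟶ M), (s ⟨x, p + q⟩ : P x ⟶ E) = s ⟨x, p⟩ + s ⟨x, q⟩ := by
    intro x p q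
    have := hs₃ ⟨x, p⟩ ⟨x, q⟩ ⟨x, p + q⟩ (𝟙 _) (𝟙 _) (-𝟙 _) (by simp; abel)
    simp only [Category.id_comp, Preadditive.neg_comp] at this
    exact (eq_of_sub_eq_zero (by rw [sub_eq_add_neg]; exact this)).symm
  have hsmul : ∀ x (c : k) (p : P x ⟶ M), (s ⟨x, c • p⟩ : P x ⟶ E) = c • s ⟨x, p⟩ := by
    intro x c p
    have := hs₃ ⟨x, p⟩ ⟨x, c • p⟩ ⟨x, p⟩ (c • 𝟙 _) (-𝟙 _) 0 (by simp)
    simp only [Category.id_comp, Preadditive.neg_comp, Linear.smul_comp, zero_comp,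
      add_zero] at this
    exact (eq_of_sub_eq_zero (by rw [sub_eq_add_neg]; exact this)).symm
  have hnat : ∀ x y (r : P y ⟶ P x) (p : P x ⟶ M),
      (s ⟨y, r ≫ p⟩ : P y ⟶ E) = r ≫ s ⟨x, p⟩ := by
    intro x y r p
    have := hs₃ ⟨x, p⟩ ⟨y, r ≫ p⟩ ⟨x, p⟩ r (-𝟙 _) 0 (by simp)
    simp only [Category.id_comp, Preadditive.neg_comp, zero_comp, add_zero] at this
    exact (eq_of_sub_eq_zero (by rw [sub_eq_add_neg]; exact this)).symm
  obtain ⟨f, hf⟩ := D.dense (fun x =>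
    { toFun := fun p => s ⟨x, p⟩, map_add' := hadd x, map_smul' := hsmul x }) hnat
  refine IsSplitEpi.mk' ⟨f, D.hom_ext fun x p => ?_⟩
  rw [← Category.assoc, hf, Category.comp_id]
  exact hs₁ x p

/-- The target of a right almost split morphism is finitely presented. -/
lemma isMatrixPresented_of_isRightAlmostSplit {E M : C} {g : E ⟶ M} (hg : IsRightAlmostSplit g) :
    IsMatrixPresented P M := by
  by_contra hM
  refine hg.1 (D.isSplitEpi_of_partial_sections g fun n m x y r p hr => ?_)
  obtain ⟨F, q, hF⟩ := exists_isMatrixPresentation r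
  obtain ⟨a, ha⟩ := hF.exists_desc p hr
  -- If `a` were a retraction, M would be a retract of the finitely presented F.
  obtain ⟨b, hb⟩ := hg.2 F a fun h =>
    hM (hF.isMatrixPresented_of_retract D.projective (section_ a) a (by simp))
  refine ⟨fun i => q i ≫ b, fun j => ?_, fun i => by simp [hb, ha]⟩
  simpa [Preadditive.sum_comp] using hF.relation j =≫ b

end NakayamaDuality

/-! ### Almost split sequences from minimal right almost split morphisms -/

section Minimal

variable {C : Type v} [Category.{w} C] [Abelian C]

/-- An idempotent endomorphism of an indecomposable object is trivial. -/
lemma CategoryTheory.Indecomposable.eq_zero_or_eq_id {M : C} (hM : Indecomposable M) {e : M ⟶ M}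
    (he : e ≫ e = e) : e = 0 ∨ e = 𝟙 M := by
  have he' : (𝟙 M - e) ≫ (𝟙 M - e) = 𝟙 M - e := by simp [he]
  obtain ⟨Y, i, p, hip, hpi⟩ := IsIdempotentComplete.idempotents_split M e he
  obtain ⟨Z, i', p', hip', hpi'⟩ := IsIdempotentComplete.idempotents_split M _ he'
  have h₁ : i ≫ p' = 0 := by
    have : Mono i' := mono_of_mono_fac (h := 𝟙 _) hip'
    rw [← cancel_mono i', Category.assoc, hpi', ← hpi]
    simp [reassoc_of% hip]
  have h₂ : i' ≫ p = 0 := by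
    have : Mono i := mono_of_mono_fac (h := 𝟙 _) hip
    have h₃ : e = 𝟙 M - p' ≫ i' := by rw [hpi']; abel
    rw [← cancel_mono i, Category.assoc, hpi, h₃]
    simp [reassoc_of% hip']
  let φ : M ≅ Y ⊞ Z :=
    { hom := biprod.lift p p'
      inv := biprod.desc i i'
      hom_inv_id := by rw [biprod.lift_desc, hpi, hpi']; abel
      inv_hom_id := by
        apply biprod.hom_ext' <;> apply biprod.hom_ext <;> simp [hip, hip', h₁, h₂] }
  rcases hM.2 Y Z φ with h | h
  · left
    rw [← hpi, h.eq_of_tgt p 0, zero_comp]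
  · right
    have : 𝟙 M - e = 0 := by rw [← hpi', h.eq_of_tgt p' 0, zero_comp]
    exact (sub_eq_zero.1 this).symm

/-- The source of a left almost split morphism is indecomposable. -/
lemma IsLeftAlmostSplit.indecomposable {L E : C} {f : L ⟶ E} (hf : IsLeftAlmostSplit f) :
    Indecomposable L := by
  refine ⟨fun h => hf.1 (IsSplitMono.mk' ⟨0, h.eq_of_src _ _⟩), fun Y Z i => ?_⟩
  by_contra! hYZ
  have h₁ : ¬ IsSplitMono (i.hom ≫ biprod.fst) := fun h => hYZ.2 <| by
    rw [IsZero.iff_id_eq_zero]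
    have h₀ : (biprod.inr : Z ⟶ Y ⊞ Z) ≫ i.inv = 0 := by
      rw [← cancel_mono (i.hom ≫ biprod.fst)]
      simp
    rw [← biprod.inr_snd (X := Y), ← i.inv_hom_id_assoc (biprod.snd), reassoc_of% h₀, zero_comp]
  have h₂ : ¬ IsSplitMono (i.hom ≫ biprod.snd) := fun h => hYZ.1 <| by
    rw [IsZero.iff_id_eq_zero]
    have h₀ : (biprod.inl : Y ⟶ Y ⊞ Z) ≫ i.inv = 0 := by
      rw [← cancel_mono (i.hom ≫ biprod.snd)]
      simp
    rw [← biprod.inl_fst (Y := Z), ← i.inv_hom_id_assoc (biprod.fst), reassoc_of% h₀, zero_comp]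
  -- If both summands are non-zero, neither projection is a section; their factorisations through f
  -- combine to a retraction of f.
  obtain ⟨a, ha⟩ := hf.2 _ _ h₁
  obtain ⟨b, hb⟩ := hf.2 _ _ h₂
  refine hf.1 (IsSplitMono.mk' ⟨(a ≫ biprod.inl + b ≫ biprod.inr) ≫ i.inv, ?_⟩)
  rw [← Category.assoc, Preadditive.comp_add, reassoc_of% ha, reassoc_of% hb,
    ← Preadditive.comp_add, biprod.total, Category.comp_id, i.hom_inv_id]

/-- The kernel of a minimal right almost split epimorphism is a left almost split morphism. -/
lemma IsRightAlmostSplit.isLeftAlmostSplit_kernel {E M : C} {g : E ⟶ M} [Epi g]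
    (hg : IsRightAlmostSplit g) (hmin : ∀ a : E ⟶ E, a ≫ g = g → IsIso a) :
    IsLeftAlmostSplit (kernel.ι g) := by
  have hex : (ShortComplex.mk (kernel.ι g) g (kernel.condition g)).Exact :=
    ShortComplex.exact_of_f_is_kernel _ (kernelIsKernel g)
  refine ⟨fun h => hg.1 ?_, fun X r hr => ?_⟩
  · let s := ShortComplex.Splitting.ofExactOfRetraction _ hex (retraction (kernel.ι g))
      (by simp) inferInstance
    exact IsSplitEpi.mk' ⟨s.s, s.s_g⟩
  -- This is the pushed-out extension of M by X. If it splits, the retraction onto X extends r to E.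
  · let g' : pushout (kernel.ι g) r ⟶ M := pushout.desc g 0 (by simp)
    have hinl : pushout.inl _ _ ≫ g' = g := pushout.inl_desc _ _ _
    have hinr : pushout.inr _ _ ≫ g' = 0 := pushout.inr_desc _ _ _
    have hepi : Epi g' := epi_of_epi_fac hinl
    by_cases hs : IsSplitEpi g'
    · have hex' : (ShortComplex.mk _ g' hinr).Exact := by
        refine ShortComplex.exact_of_g_is_cokernel _
          (CokernelCofork.IsColimit.ofπ' _ _ fun {Z} a ha => ?_)
        have h₁ : kernel.ι g ≫ pushout.inl _ r ≫ a = 0 := by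
          rw [pushout.condition_assoc]
          have : pushout.inr (kernel.ι g) r ≫ a = 0 := ha
          rw [this, comp_zero]
        refine ⟨hex.desc _ h₁, ?_⟩
        have h₂ : g ≫ hex.desc _ h₁ = pushout.inl _ r ≫ a := hex.g_desc _ h₁
        apply pushout.hom_ext
        · rw [← Category.assoc, hinl, h₂]
        · rw [← Category.assoc, hinr, zero_comp]
          exact ha.symm
      have hmono : Mono (pushout.inr (kernel.ι g) r) := inferInstance
      let s := ShortComplex.Splitting.ofExactOfSection _ hex' (section_ g') (by simp) hmono
      have hsr : pushout.inr (kernel.ι g) r ≫ s.r = 𝟙 X := s.f_r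
      refine ⟨pushout.inl _ _ ≫ s.r, ?_⟩
      rw [pushout.condition_assoc, hsr, Category.comp_id]
    -- Otherwise g' factors through g, and the induced endomorphism a of E over M is invertible by
    -- minimality. It restricts to the kernel as r followed by a morphism from X, so r would be a
    -- section.
    · exfalso
      obtain ⟨b, hb⟩ := hg.2 _ _ hs
      let a := pushout.inl (kernel.ι g) r ≫ b
      have ha : a ≫ g = g := by simp only [a, Category.assoc, hb, hinl]
      have := hmin a ha
      have hc : (pushout.inr (kernel.ι g) r ≫ b) ≫ g = 0 := by rw [Category.assoc, hb, hinr]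
      have hd : (kernel.ι g ≫ inv a) ≫ g = 0 := by
        have : inv a ≫ g = g := by rw [IsIso.inv_comp_eq, ha]
        rw [Category.assoc, this, kernel.condition]
      refine hr (IsSplitMono.mk' ⟨kernel.lift g _ hc ≫ kernel.lift g _ hd, ?_⟩)
      rw [← cancel_mono (kernel.ι g)]
      simp only [Category.assoc, kernel.lift_ι, kernel.lift_ι_assoc, Category.id_comp]
      rw [← pushout.condition_assoc]
      have : pushout.inl (kernel.ι g) r ≫ b ≫ inv a = 𝟙 _ := by
        rw [← Category.assoc]
        exact IsIso.hom_inv_id a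
      rw [this, Category.comp_id]

/-- A minimal right almost split epimorphism gives rise to an almost split sequence. -/
lemma IsRightAlmostSplit.isAlmostSplitSequence {E M : C} {g : E ⟶ M} [Epi g]
    (hM : Indecomposable M) (hg : IsRightAlmostSplit g)
    (hmin : ∀ a : E ⟶ E, a ≫ g = g → IsIso a) :
    IsAlmostSplitSequence (ShortComplex.mk (kernel.ι g) g (kernel.condition g)) where
  shortExact :=
    { exact := ShortComplex.exact_of_f_is_kernel _ (kernelIsKernel g)
      mono_f := inferInstanceAs (Mono (kernel.ι g))
      epi_g := inferInstanceAs (Epi g) }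
  not_split := ⟨fun s => hg.1 (IsSplitEpi.mk' ⟨s.s, s.s_g⟩)⟩
  indecomposable_left := (hg.isLeftAlmostSplit_kernel hmin).indecomposable
  indecomposable_right := hM
  left_almost_split := hg.isLeftAlmostSplit_kernel hmin
  right_almost_split := hg

end Minimal

namespace NakayamaDuality

variable {k : Type u} [Field k] {C : Type v} [Category.{w} C] [Abelian C]
    [Linear k C] {X : Type t} {P I : X → C} (D : NakayamaDuality k P I)

include D

/-! ### Endomorphisms of indecomposable objects -/

/-- The Fitting projector is an idempotent of an indecomposable object, hence 0 or 1. Non-invertible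
endomorphisms are therefore locally nilpotent, though not necessarily nilpotent. -/
lemma mem_eventualKer_of_not_isIso {M : C} (hM : Indecomposable M) {f : M ⟶ M} (hf : ¬ IsIso f)
    {x : X} (p : P x ⟶ M) : p ∈ eventualKer (endoAct k (P x) f) := by
  obtain ⟨e, he⟩ := D.exists_fitting f
  rcases hM.eq_zero_or_eq_id (D.fitting_idem he) with rfl | rfl
  · simpa using (he x p).2
  · exact absurd (D.isIso_of_fitting fun x p => by simpa using (he x p).1) hf

/-- Otherwise f and g are both locally nilpotent. Since g is the identity on the kernel of f, that
kernel vanishes; an injective locally nilpotent f forces M = 0. -/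
lemma isIso_or_isIso_of_add_eq_id {M : C} (hM : Indecomposable M) {f g : M ⟶ M}
    (h : f + g = 𝟙 M) : IsIso f ∨ IsIso g := by
  by_contra! hfg
  have hinj : ∀ {x} (p : P x ⟶ M), p ≫ f = 0 → p = 0 := fun {x} p hp => by
    have hpg : p ≫ g = p := by
      have := p ≫= h
      rwa [Preadditive.comp_add, hp, zero_add, Category.comp_id] at this
    obtain ⟨n, hn⟩ := mem_eventualKer.1 (D.mem_eventualKer_of_not_isIso hM hfg.2 p)
    have : ∀ n : ℕ, (endoAct k (P x) g ^ n) p = p := fun n => by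
      induction n with
      | zero => rfl
      | succ n ih => rw [pow_succ', Module.End.mul_apply, ih]; exact hpg
    rw [← this n, hn]
  refine hM.1 ((IsZero.iff_id_eq_zero _).2 (D.separating _ fun x p => ?_))
  rw [Category.comp_id]
  obtain ⟨n, hn⟩ := mem_eventualKer.1 (D.mem_eventualKer_of_not_isIso hM hfg.1 p)
  induction n with
  | zero => exact hn
  | succ n ih =>
    rw [pow_succ', Module.End.mul_apply] at hn
    exact ih (hinj _ hn)

/-- A functional on the endomorphisms of an indecomposable object whose kernel contains all
non-invertible endomorphisms. -/
lemma exists_functional_end {M : C} (hM : Indecomposable M) :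
    ∃ φ : (M ⟶ M) →ₗ[k] k, φ (𝟙 M) ≠ 0 ∧ ∀ f : M ⟶ M, ¬ IsIso f → φ f = 0 := by
  -- The non-units are closed under addition: if f + g is invertible, dividing by it gives two
  -- endomorphisms with sum 1.
  let N : Submodule k (M ⟶ M) :=
    { carrier := {f | ¬ IsIso f}
      add_mem' := fun {f g} hf hg h => by
        have h' : IsIso (f + g) := h
        rcases D.isIso_or_isIso_of_add_eq_id hM (f := f ≫ inv (f + g)) (g := g ≫ inv (f + g))
          (by rw [← Preadditive.add_comp, IsIso.hom_inv_id]) with h₁ | h₁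
        · exact hf (IsIso.of_isIso_comp_right f (inv (f + g)))
        · exact hg (IsIso.of_isIso_comp_right g (inv (f + g)))
      zero_mem' := fun h => hM.1 ((IsZero.iff_id_eq_zero _).2 (by
        have h' : IsIso (0 : M ⟶ M) := h
        rw [← IsIso.hom_inv_id (0 : M ⟶ M), zero_comp]))
      smul_mem' := fun c f hf h => hf (by
        have h' : IsIso (c • f) := h
        refine ⟨c • inv (c • f), ?_, ?_⟩
        · rw [Linear.comp_smul, ← Linear.smul_comp, IsIso.hom_inv_id]
        · rw [Linear.smul_comp, ← Linear.comp_smul, IsIso.inv_hom_id]) }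
  have h1 : 𝟙 M ∉ N := fun h => h inferInstance
  obtain ⟨φ, hφ, hN⟩ := Submodule.exists_le_ker_of_notMem h1
  exact ⟨φ, hφ, fun f hf => hN hf⟩

/-! ### Existence of right almost split morphisms -/

variable {ι κ : Type} [Fintype ι] [Fintype κ] {x : ι → X} {y : κ → X}
  {r : ∀ j i, P (y j) ⟶ P (x i)} {M : C} {p : ∀ i, P (x i) ⟶ M}

/-- The sequence 0 → Hom(M, N) → ⊕Hom(P(x_i), N) → ⊕Hom(P(y_j), N) is exact. In its dual, Hom(N, ν)
maps ⊕Hom(N, I(y_j)) to ⊕Hom(N, I(x_i)) with cokernel D Hom(M, N), so a family factors through ν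
exactly when it induces the zero functional on Hom(M, N). -/
lemma exists_factor_iff (hp : IsMatrixPresentation r p) {ν : ∀ j i, I (y j) ⟶ I (x i)}
    (hν : ∀ j i {N : C} (q : P (x i) ⟶ N) (f : N ⟶ I (y j)),
      D.tr _ (q ≫ f ≫ ν j i) = D.tr _ (r j i ≫ q ≫ f))
    (h : ∀ i, M ⟶ I (x i)) {N : C} (a : N ⟶ M) :
    (∃ l : ∀ j, N ⟶ I (y j), ∀ i, ∑ j, l j ≫ ν j i = a ≫ h i) ↔
      ∀ b : M ⟶ N, ∑ i, D.tr _ (p i ≫ b ≫ a ≫ h i) = 0 := by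
  classical
  constructor
  · rintro ⟨l, hl⟩ b
    have : ∀ i, D.tr _ (p i ≫ b ≫ a ≫ h i) = ∑ j, D.tr _ (r j i ≫ p i ≫ b ≫ l j) := fun i => by
      rw [← hl, Preadditive.comp_sum, Preadditive.comp_sum, map_sum]
      refine Finset.sum_congr rfl fun j _ => ?_
      have := hν j i (p i ≫ b) (l j)
      simpa using this
    simp only [this]
    rw [Finset.sum_comm]
    refine Finset.sum_eq_zero fun j _ => ?_
    have := hp.relation j =≫ (b ≫ l j)
    rw [zero_comp, Preadditive.sum_comp] at this
    rw [← map_sum]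
    simp only [Category.assoc] at this
    rw [this, map_zero]
  · intro hb
    let T : (∀ i, P (x i) ⟶ N) →ₗ[k] (∀ j, P (y j) ⟶ N) :=
      LinearMap.pi fun j => ∑ i, Linear.leftComp k N (r j i) ∘ₗ LinearMap.proj i
    have hT : ∀ q j, T q j = ∑ i, r j i ≫ q i := fun q j => by simp [T]
    let ψ : (∀ i, P (x i) ⟶ N) →ₗ[k] k :=
      ∑ i, D.tr (x i) ∘ₗ Linear.rightComp k _ (a ≫ h i) ∘ₗ LinearMap.proj i
    have hψ : ∀ q, ψ q = ∑ i, D.tr (x i) (q i ≫ a ≫ h i) := fun q => by simp [ψ]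
    -- The kernel of T consists of the families that factor through p, and on these ψ vanishes by
    -- `hb`.
    obtain ⟨θ, hθ⟩ := exists_functional_comp T ψ fun q hq => by
      obtain ⟨t, ht⟩ := hp.exists_desc q fun j => by rw [← hT, hq]; rfl
      rw [hψ, ← hb t]
      simp only [← ht, Category.assoc]
    have hl := fun j => D.represent (θ ∘ₗ LinearMap.single k (fun j => P (y j) ⟶ N) j)
    choose l hl using hl
    have hθl : ∀ s, θ s = ∑ j, D.tr _ (s j ≫ l j) := fun s => by
      conv_lhs => rw [← Finset.univ_sum_single s, map_sum]
      exact Finset.sum_congr rfl fun j _ => (hl j (s j)).symm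
    refine ⟨l, fun i => D.eq_of_right fun q => ?_⟩
    have h₁ := hθ (Pi.single i q)
    have h₂ : ∀ j, T (Pi.single i q) j = r j i ≫ q := fun j => by
      rw [hT, Finset.sum_eq_single i]
      · simp
      · intro i' _ hi
        rw [Pi.single_eq_of_ne hi, comp_zero]
      · simp
    have h₃ : ψ (Pi.single i q) = D.tr (x i) (q ≫ a ≫ h i) := by
      rw [hψ, Finset.sum_eq_single i]
      · simp
      · intro i' _ hi
        rw [Pi.single_eq_of_ne hi, zero_comp, map_zero]
      · simp
    rw [hθl, h₃] at h₁
    rw [← h₁, Preadditive.comp_sum, map_sum]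
    refine Finset.sum_congr rfl fun j _ => ?_
    rw [h₂, hν, Category.assoc]

/-- Restriction to the generators embeds End(M) in ∏ Hom(P(x_i), M). Extend φ to the product and
represent its components. -/
lemma exists_representing_family (hp : IsMatrixPresentation r p) (φ : (M ⟶ M) →ₗ[k] k) :
    ∃ h : ∀ i, M ⟶ I (x i), ∀ f, ∑ i, D.tr _ (p i ≫ f ≫ h i) = φ f := by
  classical
  obtain ⟨ψ, hψ⟩ := exists_functional_comp (LinearMap.pi fun i => Linear.leftComp k M (p i)) φ
    fun f hf => by
      rw [hp.jointly_epi f fun i => congrFun hf i, map_zero]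
  have hh := fun i => D.represent (ψ ∘ₗ LinearMap.single k (fun i => P (x i) ⟶ M) i)
  choose h hh using hh
  refine ⟨h, fun f => ?_⟩
  rw [← hψ f, ← Finset.univ_sum_single (LinearMap.pi (fun i => Linear.leftComp k M (p i)) f),
    map_sum]
  refine Finset.sum_congr rfl fun i _ => ?_
  rw [← Category.assoc, hh]
  rfl

/-- A finitely presented non-projective indecomposable object is the target of a right almost
split epimorphism whose kernel is finitely co-generated. -/
lemma exists_isRightAlmostSplit (hM : Indecomposable M) (hproj : ¬ Projective M)
    (hp : IsMatrixPresentation r p) :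
    ∃ (E : C) (g : E ⟶ M), IsRightAlmostSplit g ∧ Epi g ∧
      ∀ {N : C} (a : N ⟶ E), a ≫ g = 0 → (∀ j (q : P (y j) ⟶ N), q ≫ a = 0) → a = 0 := by
  classical
  have := Abelian.hasFiniteBiproducts (C := C)
  obtain ⟨φ, hφ₁, hφ⟩ := D.exists_functional_end hM
  obtain ⟨h, hh⟩ := D.exists_representing_family hp φ
  have hν := fun j i => D.exists_nakayama (r j i)
  choose ν hν using hν
  have hiff := fun {N : C} (a : N ⟶ M) => D.exists_factor_iff hp hν h a
  -- The kernel of n plays the role of the Auslander–Reiten translate of M, and its pullback along m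
  -- is the extension determined by φ.
  let n := biproduct.matrix ν
  let m := biproduct.lift h
  have hlift : ∀ {N : C} (a : N ⟶ M), (∃ b : N ⟶ pullback n m, b ≫ pullback.snd n m = a) ↔
      ∀ b : M ⟶ N, φ (b ≫ a) = 0 := fun {N} a => by
    have hφa : ∀ b : M ⟶ N, ∑ i, D.tr _ (p i ≫ b ≫ a ≫ h i) = φ (b ≫ a) := fun b => by
      rw [← hh]
      simp
    simp only [← hφa]
    rw [← hiff]
    constructor
    · rintro ⟨b, rfl⟩
      refine ⟨fun j => b ≫ pullback.fst n m ≫ biproduct.π _ j, fun i => ?_⟩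
      have := b ≫= pullback.condition (f := n) (g := m) =≫ biproduct.π _ i
      simp only [n, m, Category.assoc, biproduct.lift_π, biproduct.matrix_π,
        biproduct.desc_eq, Preadditive.comp_sum] at this ⊢
      exact this
    · rintro ⟨l, hl⟩
      refine ⟨pullback.lift (biproduct.lift l) a ?_, pullback.lift_snd _ _ _⟩
      ext i
      simp [n, m, biproduct.lift_desc, hl]
  have hras : IsRightAlmostSplit (pullback.snd n m) := by
    -- A section would lift the identity and give φ(1) = 0; and if `b ≫ a` is invertible, then a is
    -- a retraction.
    refine ⟨fun hs => hφ₁ ?_, fun N a ha => (hlift a).2 fun b => hφ _ fun hi => ha ?_⟩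
    · have := (hlift (𝟙 M)).1 ⟨section_ (pullback.snd n m), by simp⟩ (𝟙 M)
      simpa using this
    · exact IsSplitEpi.mk' ⟨inv (b ≫ a) ≫ b, by simp⟩
  refine ⟨pullback n m, pullback.snd n m, hras, ?_, fun {N} a ha hq => ?_⟩
  · have hP : Projective (⨁ fun i => P (x i)) :=
      { factors := fun f e _ => by
          have := D.projective
          exact ⟨biproduct.desc fun i =>
              Projective.factorThru (biproduct.ι (fun i => P (x i)) i ≫ f) e,
            biproduct.hom_ext' _ _ fun i => by simp⟩ }
    have hd : Epi (biproduct.desc p) := Preadditive.epi_of_cancel_zero _ fun {N} g hg =>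
      hp.jointly_epi g fun i => by simpa using biproduct.ι _ i ≫= hg
    -- The projective cover by generators is not split because M is not projective, so it factors
    -- through the projection, which is therefore epi.
    obtain ⟨b, hb⟩ := hras.2 _ (biproduct.desc p) fun hs => hproj
      (Retract.projective ⟨section_ (biproduct.desc p), biproduct.desc p, by simp⟩)
    exact epi_of_epi_fac hb
  · apply pullback.hom_ext
    · ext j
      simp only [Category.assoc, zero_comp]
      -- A morphism to I(y_j) is determined by its composites with the morphisms from P(y_j).
      refine D.eq_zero_right _ fun q => ?_
      rw [← Category.assoc, hq, zero_comp, map_zero]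
    · rw [ha, zero_comp]

/-! ### Minimal right almost split morphisms -/

/-- A right almost split epimorphism with finitely co-generated kernel can be replaced by a
minimal one. -/
lemma exists_minimal (y : κ → X)
    (hex : ∃ (E : C) (g : E ⟶ M), IsRightAlmostSplit g ∧ Epi g ∧
      ∀ {N : C} (a : N ⟶ E), a ≫ g = 0 → (∀ j (q : P (y j) ⟶ N), q ≫ a = 0) → a = 0) :
    ∃ (E : C) (g : E ⟶ M), IsRightAlmostSplit g ∧ Epi g ∧ ∀ a : E ⟶ E, a ≫ g = g → IsIso a := by
  classical
  -- E may have infinite total dimension; only its dimensions at the finitely many y_j controlling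
  -- the kernel of g are minimised.
  let d : C → ℕ := fun E => ∑ j, Module.finrank k (P (y j) ⟶ E)
  let p : ℕ → Prop := fun n => ∃ (E : C) (g : E ⟶ M), (IsRightAlmostSplit g ∧ Epi g ∧
      ∀ {N : C} (a : N ⟶ E), a ≫ g = 0 → (∀ j (q : P (y j) ⟶ N), q ≫ a = 0) → a = 0) ∧ d E = n
  have hpn : ∃ n, p n := by
    obtain ⟨E, g, h⟩ := hex
    exact ⟨_, E, g, h, rfl⟩
  obtain ⟨E, g, ⟨hg, hepi, hker⟩, hd⟩ := Nat.find_spec hpn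
  refine ⟨E, g, hg, hepi, fun a ha => ?_⟩
  obtain ⟨e, he⟩ := D.exists_fitting a
  -- Since a^n g = g for all n, the eventual kernel of a is killed by g. The image of e then carries
  -- a right almost split morphism of the same kind.
  have heg : e ≫ g = g := D.hom_ext fun z q => by
    obtain ⟨n, hn⟩ := mem_eventualKer.1 (he z q).2
    have h₁ : ∀ (n : ℕ) (q : P z ⟶ E), (endoAct k (P z) a ^ n) q ≫ g = q ≫ g := fun n => by
      induction n with
      | zero => exact fun q => rfl
      | succ n ih =>
        intro q
        rw [pow_succ, Module.End.mul_apply, ih, Linear.rightComp_apply, Category.assoc, ha]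
    have h₂ := h₁ n (q - q ≫ e)
    rw [hn, zero_comp, Preadditive.sub_comp, eq_comm, sub_eq_zero] at h₂
    rw [h₂, Category.assoc]
  obtain ⟨E', i, π, hiπ, hπi⟩ := IsIdempotentComplete.idempotents_split E e (D.fitting_idem he)
  have hi : Mono i := mono_of_mono_fac (h := 𝟙 _) hiπ
  have hπg : π ≫ i ≫ g = g := by rw [← Category.assoc, hπi, heg]
  have hp' : p (d E') := by
    refine ⟨E', i ≫ g, ⟨⟨fun hs => hg.1 ?_, fun N b hb => ?_⟩, epi_of_epi_fac hπg,
      fun {N} b hb hq => ?_⟩, rfl⟩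
    · exact IsSplitEpi.mk' ⟨section_ (i ≫ g) ≫ i, by simp⟩
    · obtain ⟨c, hc⟩ := hg.2 N b hb
      exact ⟨c ≫ π, by rw [Category.assoc, hπg, hc]⟩
    · rw [← cancel_mono i, zero_comp]
      exact hker _ (by rw [Category.assoc, hb]) fun j q => by
        rw [← Category.assoc, hq, zero_comp]
  have hle : ∀ j, Module.finrank k (P (y j) ⟶ E') ≤ Module.finrank k (P (y j) ⟶ E) := fun j => by
    have := D.finite (y j) E
    exact LinearMap.finrank_le_finrank_of_injective (f := Linear.rightComp k (P (y j)) i)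
      fun q q' h => (cancel_mono i).1 h
  have heq : ∀ j, Module.finrank k (P (y j) ⟶ E') = Module.finrank k (P (y j) ⟶ E) := by
    have h₁ : d E ≤ d E' := hd.trans_le (Nat.find_min' hpn hp')
    have h₂ := (Finset.sum_eq_sum_iff_of_le fun j _ => hle j).1
      (le_antisymm (Finset.sum_le_sum fun j _ => hle j) h₁)
    exact fun j => h₂ j (Finset.mem_univ j)
  -- By minimality i is bijective on morphisms from each P(y_j), so 1 - e vanishes there; as it is
  -- also killed by g, it is zero.
  have he1 : 𝟙 E - e = 0 := by
    refine hker _ (by simp [heg]) fun j q => ?_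
    have := D.finite (y j) E
    have := D.finite (y j) E'
    have hsurj := (LinearMap.injective_iff_surjective_of_finrank_eq_finrank (heq j)
      (f := Linear.rightComp k (P (y j)) i)).1 fun q q' h => (cancel_mono i).1 h
    obtain ⟨q', rfl⟩ := hsurj q
    simp [← hπi, reassoc_of% hiπ]
  rw [sub_eq_zero] at he1
  exact D.isIso_of_fitting fun z q => by simpa [← he1] using (he z q).1

/-- The existence theorem for almost split sequences with prescribed end term. -/
theorem exists_isAlmostSplitSequence_iff (hM : Indecomposable M) :
    (∃ S : ShortComplex C, IsAlmostSplitSequence S ∧ Nonempty (S.X₃ ≅ M)) ↔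
      IsMatrixPresented P M ∧ ¬ Projective M := by
  constructor
  · rintro ⟨S, hS, ⟨i⟩⟩
    obtain ⟨n, m, x, y, r, p, hp⟩ := D.isMatrixPresented_of_isRightAlmostSplit
      hS.right_almost_split
    refine ⟨hp.isMatrixPresented_of_retract D.projective i.inv i.hom i.inv_hom_id, fun h => ?_⟩
    have := hS.shortExact.epi_g
    have : Projective S.X₃ := Projective.of_iso i.symm h
    exact hS.right_almost_split.1 (IsSplitEpi.mk' ⟨Projective.factorThru (𝟙 _) S.g, by simp⟩)
  · rintro ⟨⟨n, m, x, y, r, p, hp⟩, h⟩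
    obtain ⟨E, g, hg, hepi, hmin⟩ := D.exists_minimal y (D.exists_isRightAlmostSplit hM h hp)
    exact ⟨_, hg.isAlmostSplitSequence hM hmin, ⟨Iso.refl _⟩⟩

end NakayamaDuality

/-! ### Finite presentations in terms of biproducts -/

section FinPresented

variable {C : Type v} [Category.{w} C] [Abelian C] [HasFiniteBiproducts C] {X : Type t}

/-- Both sides express exactness of ⊕P(y_j) → ⊕P(x_i) → M → 0; the matrix form carries over to the
opposite category entry by entry. -/
lemma isMatrixPresented_iff (P : X → C) (M : C) :
    (∃ (n : ℕ) (x : Fin n → X) (f : (⨁ fun i => P (x i)) ⟶ M), Epi f ∧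
      ∃ (m : ℕ) (y : Fin m → X) (g : (⨁ fun j => P (y j)) ⟶ kernel f), Epi g) ↔
      IsMatrixPresented P M := by
  constructor
  · rintro ⟨n, x, f, hf, m, y, g, hg⟩
    refine ⟨n, m, x, y, fun j i => biproduct.ι (fun j => P (y j)) j ≫ g ≫ kernel.ι f ≫
      biproduct.π _ i, fun i => biproduct.ι (fun i => P (x i)) i ≫ f, fun j => ?_,
      fun {N} h hh => ?_, fun {N} h hh => ?_⟩
    · have : ∀ i, (biproduct.ι (fun j => P (y j)) j ≫ g ≫ kernel.ι f ≫ biproduct.π _ i) ≫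
          biproduct.ι (fun i => P (x i)) i ≫ f = (biproduct.ι (fun j => P (y j)) j ≫ g ≫
            kernel.ι f) ≫ (biproduct.π _ i ≫ biproduct.ι (fun i => P (x i)) i) ≫ f := by simp
      simp only [this]
      rw [← Preadditive.comp_sum, ← Preadditive.sum_comp, biproduct.total]
      simp
    · rw [← cancel_epi f, comp_zero]
      ext i
      simpa using hh i
    · have h₁ : kernel.ι f ≫ biproduct.desc h = 0 := by
        rw [← cancel_epi g, comp_zero]
        ext j
        simpa [biproduct.desc_eq, Preadditive.comp_sum] using hh j
      exact ⟨Abelian.epiDesc f _ h₁, fun i => by simp [Abelian.comp_epiDesc]⟩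
  · rintro ⟨n, m, x, y, r, p, hp⟩
    have hf : Epi (biproduct.desc p) := Preadditive.epi_of_cancel_zero _ fun {N} g hg =>
      hp.jointly_epi g fun i => by simpa using biproduct.ι (fun i => P (x i)) i ≫= hg
    have h0 : biproduct.matrix r ≫ biproduct.desc p = 0 := by
      ext j
      simp [biproduct.matrix_desc, hp.relation]
    have hex : (ShortComplex.mk _ _ h0).Exact := by
      refine ShortComplex.exact_of_g_is_cokernel _
        (CokernelCofork.IsColimit.ofπ' _ _ fun {N} a ha => ?_)
      have := hp.exists_desc (fun i => biproduct.ι (fun i => P (x i)) i ≫ a) fun j => by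
        have h₁ : biproduct.ι (fun j => P (y j)) j ≫ biproduct.matrix r ≫ a = 0 := by
          rw [show biproduct.matrix r ≫ a = 0 from ha, comp_zero]
        rw [biproduct.ι_matrix_assoc, biproduct.lift_eq, Preadditive.sum_comp] at h₁
        simpa using h₁
      exact ⟨this.choose, by
        ext i
        simpa using this.choose_spec i⟩
    rw [ShortComplex.exact_iff_epi_kernel_lift] at hex
    exact ⟨n, x, biproduct.desc p, hf, m, y, _, hex⟩

lemma isMatrixPresented_op_iff (I : X → C) (M : C) :
    (∃ (n : ℕ) (x : Fin n → X) (f : M ⟶ ⨁ fun i => I (x i)), Mono f ∧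
      ∃ (m : ℕ) (y : Fin m → X) (g : cokernel f ⟶ ⨁ fun j => I (y j)), Mono g) ↔
      IsMatrixPresented (fun x => Opposite.op (I x)) (Opposite.op M) := by
  constructor
  · rintro ⟨n, x, f, hf, m, y, g, hg⟩
    refine ⟨n, m, x, y, fun j i => (biproduct.ι (fun i => I (x i)) i ≫ cokernel.π f ≫ g ≫
      biproduct.π _ j).op, fun i => (f ≫ biproduct.π (fun i => I (x i)) i).op, fun j => ?_,
      fun {N} h hh => ?_, fun {N} h hh => ?_⟩
    · have : ∀ i, (f ≫ biproduct.π _ i) ≫ biproduct.ι (fun i => I (x i)) i ≫ cokernel.π f ≫ g ≫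
          biproduct.π (fun j => I (y j)) j = f ≫ (biproduct.π _ i ≫
            biproduct.ι (fun i => I (x i)) i) ≫ cokernel.π f ≫ g ≫ biproduct.π _ j := by simp
      simp only [← op_comp, this]
      rw [← op_sum, ← Preadditive.comp_sum, ← Preadditive.sum_comp, biproduct.total]
      simp
    · refine Quiver.Hom.unop_inj ?_
      change h.unop = 0
      rw [← cancel_mono f, zero_comp]
      ext i
      simpa using congrArg Quiver.Hom.unop (hh i)
    · have h₁ : biproduct.lift (fun i => (h i).unop) ≫ cokernel.π f = 0 := by
        rw [← cancel_mono g, zero_comp]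
        ext j
        simpa [biproduct.lift_eq, Preadditive.sum_comp] using congrArg Quiver.Hom.unop (hh j)
      refine ⟨(Abelian.monoLift f _ h₁).op, fun i => Quiver.Hom.unop_inj ?_⟩
      simp [← Category.assoc, Abelian.monoLift_comp]
  · rintro ⟨n, m, x, y, r, p, hp⟩
    have hf : Mono (biproduct.lift fun i => (p i).unop) :=
      Preadditive.mono_of_cancel_zero _ fun {N} g hg => Quiver.Hom.op_inj <|
        hp.jointly_epi g.op fun i => Quiver.Hom.unop_inj <| by
          simpa using hg =≫ biproduct.π (fun i => I (x i)) i
    let s : (⨁ fun i => I (x i)) ⟶ ⨁ fun j => I (y j) := biproduct.matrix fun i j => (r j i).unop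
    have h0 : (biproduct.lift fun i => (p i).unop) ≫ s = 0 := by
      ext j
      have := congrArg Quiver.Hom.unop (hp.relation j)
      simpa [s, biproduct.lift_desc] using this
    have hex : (ShortComplex.mk _ _ h0).Exact := by
      refine ShortComplex.exact_of_f_is_kernel _
        (KernelFork.IsLimit.ofι' _ _ fun {N} a ha => ?_)
      have := hp.exists_desc (fun i => (a ≫ biproduct.π (fun i => I (x i)) i).op) fun j => by
        have h₁ : (a ≫ s) ≫ biproduct.π (fun j => I (y j)) j = 0 := by
          rw [show a ≫ s = 0 from ha, zero_comp]
        rw [Category.assoc, biproduct.matrix_π, biproduct.desc_eq, Preadditive.comp_sum] at h₁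
        exact Quiver.Hom.unop_inj (by simpa using h₁)
      exact ⟨this.choose.unop, by
        ext i
        simpa using congrArg Quiver.Hom.unop (this.choose_spec i)⟩
    rw [ShortComplex.exact_iff_mono_cokernel_desc] at hex
    exact ⟨n, x, _, hf, m, y, _, hex⟩

end FinPresented

/-! ### Almost split sequences in the opposite category -/

section Opposite

variable {C : Type v} [Category.{w} C]

lemma isSplitEpi_op_iff {X Y : C} {f : X ⟶ Y} : IsSplitEpi f.op ↔ IsSplitMono f :=
  ⟨fun _ => IsSplitMono.mk' ⟨(section_ f.op).unop, Quiver.Hom.op_inj (IsSplitEpi.id f.op)⟩,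
    fun _ => IsSplitEpi.mk' ⟨(retraction f).op, Quiver.Hom.unop_inj (IsSplitMono.id f)⟩⟩

lemma isSplitMono_op_iff {X Y : C} {f : X ⟶ Y} : IsSplitMono f.op ↔ IsSplitEpi f :=
  ⟨fun _ => IsSplitEpi.mk' ⟨(retraction f.op).unop, Quiver.Hom.op_inj (IsSplitMono.id f.op)⟩,
    fun _ => IsSplitMono.mk' ⟨(section_ f).op, Quiver.Hom.unop_inj (IsSplitEpi.id f)⟩⟩

lemma isRightAlmostSplit_op_iff {X Y : C} {f : X ⟶ Y} :
    IsRightAlmostSplit f.op ↔ IsLeftAlmostSplit f := by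
  refine and_congr (not_congr isSplitEpi_op_iff) ⟨fun h L g hg => ?_, fun h L g hg => ?_⟩
  · obtain ⟨a, ha⟩ := h _ g.op (mt isSplitEpi_op_iff.1 hg)
    exact ⟨a.unop, Quiver.Hom.op_inj ha⟩
  · obtain ⟨a, ha⟩ := h _ g.unop (mt isSplitEpi_op_iff.2 hg)
    exact ⟨a.op, Quiver.Hom.unop_inj ha⟩

lemma isLeftAlmostSplit_op_iff {X Y : C} {f : X ⟶ Y} :
    IsLeftAlmostSplit f.op ↔ IsRightAlmostSplit f := by
  refine and_congr (not_congr isSplitMono_op_iff) ⟨fun h L g hg => ?_, fun h L g hg => ?_⟩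
  · obtain ⟨a, ha⟩ := h _ g.op (mt isSplitMono_op_iff.1 hg)
    exact ⟨a.unop, Quiver.Hom.op_inj ha⟩
  · obtain ⟨a, ha⟩ := h _ g.unop (mt isSplitMono_op_iff.2 hg)
    exact ⟨a.op, Quiver.Hom.unop_inj ha⟩

variable [Abelian C]

/-- This form of indecomposability is visibly self-dual. -/
lemma indecomposable_iff_idempotents (M : C) : Indecomposable M ↔
    𝟙 M ≠ 0 ∧ ∀ e : M ⟶ M, e ≫ e = e → e = 0 ∨ e = 𝟙 M := by
  refine ⟨fun h => ⟨mt (IsZero.iff_id_eq_zero M).2 h.1, fun e he => h.eq_zero_or_eq_id he⟩,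
    fun ⟨h, he⟩ => ⟨mt (IsZero.iff_id_eq_zero M).1 h, fun Y Z φ => ?_⟩⟩
  rcases he (φ.hom ≫ biprod.fst ≫ biprod.inl ≫ φ.inv) (by simp) with h₁ | h₁
  · left
    have := (biprod.inl ≫ φ.inv) ≫= h₁ =≫ (φ.hom ≫ biprod.fst)
    rw [IsZero.iff_id_eq_zero]
    simpa using this
  · right
    have := (biprod.inr ≫ φ.inv) ≫= h₁ =≫ (φ.hom ≫ biprod.snd)
    rw [IsZero.iff_id_eq_zero]
    simpa using this.symm

lemma indecomposable_op_iff (M : C) : Indecomposable (Opposite.op M) ↔ Indecomposable M := by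
  simp only [indecomposable_iff_idempotents]
  refine and_congr (not_congr ⟨fun h => Quiver.Hom.op_inj h, fun h => Quiver.Hom.unop_inj h⟩)
    ⟨fun h e he => ?_, fun h e he => ?_⟩
  · exact (h e.op (Quiver.Hom.unop_inj he)).imp (fun h => Quiver.Hom.op_inj h)
      fun h => Quiver.Hom.op_inj h
  · exact (h e.unop (Quiver.Hom.op_inj he)).imp (fun h => Quiver.Hom.unop_inj h)
      fun h => Quiver.Hom.unop_inj h

lemma IsAlmostSplitSequence.op {S : ShortComplex C} (hS : IsAlmostSplitSequence S) :
    IsAlmostSplitSequence S.op where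
  shortExact := hS.shortExact.op
  not_split := ⟨fun s => hS.not_split.false s.unop⟩
  indecomposable_left := (indecomposable_op_iff _).2 hS.indecomposable_right
  indecomposable_right := (indecomposable_op_iff _).2 hS.indecomposable_left
  left_almost_split := isLeftAlmostSplit_op_iff.2 hS.right_almost_split
  right_almost_split := isRightAlmostSplit_op_iff.2 hS.left_almost_split

lemma IsAlmostSplitSequence.unop {S : ShortComplex Cᵒᵖ} (hS : IsAlmostSplitSequence S) :
    IsAlmostSplitSequence S.unop where
  shortExact := hS.shortExact.unop
  not_split := ⟨fun s => hS.not_split.false s.op⟩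
  indecomposable_left := (indecomposable_op_iff _).1 hS.indecomposable_right
  indecomposable_right := (indecomposable_op_iff _).1 hS.indecomposable_left
  left_almost_split := isRightAlmostSplit_op_iff.1 hS.right_almost_split
  right_almost_split := isLeftAlmostSplit_op_iff.1 hS.left_almost_split

lemma exists_isAlmostSplitSequence_op_iff (M : C) :
    (∃ S : ShortComplex Cᵒᵖ, IsAlmostSplitSequence S ∧ Nonempty (S.X₃ ≅ Opposite.op M)) ↔
      ∃ S : ShortComplex C, IsAlmostSplitSequence S ∧ Nonempty (S.X₁ ≅ M) :=
  ⟨fun ⟨S, hS, ⟨i⟩⟩ => ⟨S.unop, hS.unop, ⟨i.symm.unop⟩⟩,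
    fun ⟨S, hS, ⟨i⟩⟩ => ⟨S.op, hS.op, ⟨i.symm.op⟩⟩⟩

end Opposite

/-! ### The Nakayama duality of a bound quiver -/

section BoundQuiver

variable {k : Type u} [Field k] {Q : Type v} [Quiver.{w} Q] (I : LinearIdeal k (PathCat k Q))

lemma hom_naturality_apply {M N : BoundRep I} (f : M ⟶ N) {y z : I.QuotientCat} (a : y ⟶ z)
    (m : M.obj.obj y) :
    (f.hom.app z).hom ((M.obj.map a).hom m) = (N.obj.map a).hom ((f.hom.app y).hom m) :=
  congrArg (fun φ => φ.hom m) (f.hom.naturality a)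

lemma boundRep_hom_ext {M N : BoundRep I} {f g : M ⟶ N}
    (h : ∀ (x : Q) m, (f.hom.app (vertex I x)).hom m = (g.hom.app (vertex I x)).hom m) :
    f = g := by
  apply ObjectProperty.hom_ext
  apply NatTrans.ext
  funext y
  ext m
  exact h y.as m

/-- The cokernel of f among all functors is a quotient of N, hence locally finite dimensional, so f
being epi in the subcategory already forces it to vanish. -/
lemma surjective_app_of_epi {M N : BoundRep I} (f : M ⟶ N) [Epi f] (y : I.QuotientCat) :
    Function.Surjective (f.hom.app y).hom := by
  have hc : locFinRep k I.QuotientCat (cokernel f.hom) :=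
    (locFinRep k I.QuotientCat).prop_of_epi (cokernel.π f.hom) N.property
  let q : N ⟶ ⟨cokernel f.hom, hc⟩ := ObjectProperty.homMk (cokernel.π f.hom)
  have hq : q = 0 := by
    rw [← cancel_epi f, comp_zero]
    exact ObjectProperty.hom_ext _ (cokernel.condition f.hom)
  have h0 : cokernel.π f.hom = 0 := congrArg InducedCategory.Hom.hom hq
  have : Epi f.hom := Preadditive.epi_of_cokernel_zero h0
  exact (ModuleCat.epi_iff_surjective (f.hom.app y)).1 inferInstance

variable [IsBoundQuiver I]

/-- The morphism `P_x ⟶ M` corresponding to an element of `M(x)`. -/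
noncomputable def yonedaHom {x : Q} {M : BoundRep I} (m : M.obj.obj (vertex I x)) :
    projRep I x ⟶ M :=
  ObjectProperty.homMk
    { app := fun y => ModuleCat.ofHom
        { toFun := fun a => (M.obj.map a).hom m
          map_add' := fun a b => by
            have := M.property.additive
            rw [M.obj.map_add]
            rfl
          map_smul' := fun c a => by
            have := M.property.additive
            have := M.property.linear
            rw [M.obj.map_smul]
            rfl }
      naturality := fun y z f => by
        ext a
        change vertex I x ⟶ y at a
        exact congrArg (fun φ => φ.hom m) (M.obj.map_comp a f) }

lemma yonedaHom_app {x : Q} {M : BoundRep I} (m : M.obj.obj (vertex I x)) {y : I.QuotientCat}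
    (a : vertex I x ⟶ y) : ((yonedaHom I m).hom.app y).hom a = (M.obj.map a).hom m := rfl

/-- The Yoneda isomorphism between `Hom (P_x, M)` and `M(x)`. -/
noncomputable def yonedaEval (x : Q) (M : BoundRep I) :
    (projRep I x ⟶ M) ≃ₗ[k] M.obj.obj (vertex I x) where
  toFun p := (p.hom.app (vertex I x)).hom (𝟙 (vertex I x))
  map_add' _ _ := rfl
  map_smul' _ _ := rfl
  invFun := yonedaHom I
  left_inv p := boundRep_hom_ext I fun y a => by
    change vertex I x ⟶ vertex I y at a
    rw [yonedaHom_app]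
    refine (hom_naturality_apply I p a (𝟙 (vertex I x))).symm.trans ?_
    exact congrArg (p.hom.app (vertex I y)).hom (Category.id_comp a)
  right_inv m := by
    change (M.obj.map (𝟙 (vertex I x))).hom m = m
    rw [M.obj.map_id]
    rfl

lemma yonedaEval_comp {x : Q} {M N : BoundRep I} (p : projRep I x ⟶ M) (f : M ⟶ N) :
    yonedaEval I x N (p ≫ f) = (f.hom.app (vertex I x)).hom (yonedaEval I x M p) := rfl

lemma yonedaEval_symm_comp {x : Q} {M N : BoundRep I} (m : M.obj.obj (vertex I x)) (f : M ⟶ N) :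
    (yonedaEval I x M).symm m ≫ f =
      (yonedaEval I x N).symm ((f.hom.app (vertex I x)).hom m) := by
  rw [LinearEquiv.eq_symm_apply, yonedaEval_comp, LinearEquiv.apply_symm_apply]

/-- The morphism `M ⟶ I_x` corresponding to a functional on `M(x)`. -/
noncomputable def coyonedaHom {x : Q} {M : BoundRep I}
    (φ : Module.Dual k (M.obj.obj (vertex I x))) : M ⟶ injRep I x :=
  ObjectProperty.homMk
    { app := fun y => ModuleCat.ofHom
        (LinearMap.mk₂ k (fun (m : M.obj.obj y) (a : y ⟶ vertex I x) => φ ((M.obj.map a).hom m))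
          (fun m m' a => by rw [map_add, map_add])
          (fun c m a => by rw [map_smul, map_smul])
          (fun m a b => by
            have := M.property.additive
            rw [M.obj.map_add, ModuleCat.hom_add, LinearMap.add_apply, map_add])
          (fun c m a => by
            have := M.property.additive
            have := M.property.linear
            rw [M.obj.map_smul, ModuleCat.hom_smul, LinearMap.smul_apply, map_smul]))
      naturality := fun y z f => by
        ext m
        apply LinearMap.ext
        intro a
        change φ ((M.obj.map a).hom ((M.obj.map f).hom m)) = φ ((M.obj.map (f ≫ a)).hom m)
        rw [M.obj.map_comp]
        rfl }

/-- The elements of `I_x(y)` are the functionals on the space of morphisms from `y` to `x`. -/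
noncomputable def injRepEquiv (x : Q) (y : I.QuotientCat) :
    (injRep I x).obj.obj y ≃ₗ[k] Module.Dual k (y ⟶ vertex I x) :=
  LinearEquiv.refl k (Module.Dual k (y ⟶ vertex I x))

/-- The representations `P_x` and `I_x` form a Nakayama duality. -/
noncomputable def boundQuiverDuality : NakayamaDuality k (projRep I) (injRep I) where
  tr x := LinearMap.applyₗ (𝟙 (vertex I x)) ∘ₗ (injRepEquiv I x (vertex I x)).toLinearMap ∘ₗ
    (yonedaEval I x (injRep I x)).toLinearMap
  finite x M := by
    have := M.property.finite (vertex I x)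
    exact Module.Finite.equiv (yonedaEval I x M).symm
  projective x :=
    { factors := fun {E N} f e _ => by
        obtain ⟨m, hm⟩ := surjective_app_of_epi I e (vertex I x) (yonedaEval I x N f)
        exact ⟨(yonedaEval I x E).symm m, by
          rw [yonedaEval_symm_comp, hm, LinearEquiv.symm_apply_apply]⟩ }
  separating {M N} f h := boundRep_hom_ext I fun x m => by
    have := congrArg (yonedaEval I x N) (h x ((yonedaEval I x M).symm m))
    rwa [yonedaEval_comp, LinearEquiv.apply_symm_apply] at this
  represent {x M} φ := by
    refine ⟨coyonedaHom I (φ ∘ₗ (yonedaEval I x M).symm.toLinearMap), fun p => ?_⟩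
    change φ ((yonedaEval I x M).symm ((M.obj.map (𝟙 _)).hom (yonedaEval I x M p))) = φ p
    rw [M.obj.map_id]
    exact congrArg φ (LinearEquiv.symm_apply_apply _ _)
  eq_zero_right {x M} f h := boundRep_hom_ext I fun y m => LinearMap.ext fun a => by
    change vertex I y ⟶ vertex I x at a
    -- By naturality the value of f(m) at a is the value of f(M(a)m) at the identity, which is a
    -- trace.
    have h₁ := h ((yonedaEval I x M).symm ((M.obj.map a).hom m))
    rw [yonedaEval_symm_comp, hom_naturality_apply, LinearMap.comp_apply, LinearMap.comp_apply,
      LinearEquiv.coe_coe, LinearEquiv.coe_coe, LinearEquiv.apply_symm_apply] at h₁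
    refine Eq.trans ?_ h₁
    exact congrArg (injRepEquiv I x (vertex I y) ((f.hom.app (vertex I y)).hom m))
      (Category.comp_id a).symm
  dense {M N} s hs := by
    have key : ∀ (y z : Q) (a : vertex I y ⟶ vertex I z) (m : M.obj.obj (vertex I y)),
        yonedaEval I z N (s z ((yonedaEval I z M).symm ((M.obj.map a).hom m))) =
          (N.obj.map a).hom (yonedaEval I y N (s y ((yonedaEval I y M).symm m))) := by
      intro y z a m
      have h : ∀ {M : BoundRep I} (m : M.obj.obj (vertex I y)),
          (yonedaEval I z M).symm ((M.obj.map a).hom m) =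
            (yonedaEval I z (projRep I y)).symm a ≫ (yonedaEval I y M).symm m :=
        fun {M} m => (yonedaEval_symm_comp I (M := projRep I y) a ((yonedaEval I y M).symm m)).symm
      rw [h, hs, ← LinearEquiv.eq_symm_apply, h, LinearEquiv.symm_apply_apply]
    refine ⟨ObjectProperty.homMk
      { app := fun y => ModuleCat.ofHom ((yonedaEval I y.as N).toLinearMap ∘ₗ s y.as ∘ₗ
          (yonedaEval I y.as M).symm.toLinearMap)
        naturality := fun y z a => by
          ext m
          exact key y.as z.as a m }, fun x p => ?_⟩
    · apply (yonedaEval I x N).injective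
      rw [yonedaEval_comp]
      change yonedaEval I x N (s x ((yonedaEval I x M).symm (yonedaEval I x M p))) = _
      rw [LinearEquiv.symm_apply_apply]

variable {I}

lemma isFinPresented_iff (M : BoundRep I) :
    IsFinPresented M ↔ IsMatrixPresented (projRep I) M :=
  isMatrixPresented_iff (projRep I) M

lemma isFinCopresented_iff (M : BoundRep I) : IsFinCopresented M ↔
    IsMatrixPresented (fun x => Opposite.op (injRep I x)) (Opposite.op M) :=
  isMatrixPresented_op_iff (injRep I) M

end BoundQuiver

/-! ### Almost split sequences for bound quivers -/

theorem mainTheorem1 {k : Type u} [Field k] {Q : Type v} [Quiver.{w} Q] [Countable Q]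
    (I : LinearIdeal k (PathCat k Q)) [IsBoundQuiver I]
    (M : BoundRep I) (hM : Indecomposable M) :
    ((∃ S : ShortComplex (BoundRep I), IsAlmostSplitSequence S ∧ Nonempty (S.X₃ ≅ M)) ↔
      IsFinPresented M ∧ ¬ Projective M) ∧
    ((∃ S : ShortComplex (BoundRep I), IsAlmostSplitSequence S ∧ Nonempty (S.X₁ ≅ M)) ↔
      IsFinCopresented M ∧ ¬ Injective M) := by
  refine ⟨?_, ?_⟩
  · rw [isFinPresented_iff]
    exact (boundQuiverDuality I).exists_isAlmostSplitSequence_iff hM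
  · rw [isFinCopresented_iff, Injective.injective_iff_projective_op,
      ← exists_isAlmostSplitSequence_op_iff]
    exact (boundQuiverDuality I).op.exists_isAlmostSplitSequence_iff
      ((indecomposable_op_iff M).2 hM)
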